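/- Let $\mathbb Z^2$ be the standard lattice graph ($x\sim y$ iff $|x_1-y_1|+|x_2-y_2|=1$). Consider two random walks on it: the simple random walk (SRW), which at each step moves to a uniformly chosen neighbour, and the lazy simple random walk (LSRW), which at each step stays put with probability $1/2$ and otherwise moves to a uniformly chosen neighbour. For either walk let $P$ be the transition matrix and $p_t(x,y)=\mathbb P_x[X_t=y]$. For a finite set $H\subset\mathbb Z^2$ let $\tau_H$ be the first time at which the walk is outside $H$, and let $p_t^H(x,y)=\mathbb P_x[X_t=y,\ t<\tau_H]$, $G_H(x,y)=\sum_{t\ge 0}p_t^H(x,y)$ and $Z_H(1)=\sum_{x\in H}G_H(x,x)$. Let $\mathcal L_H=(I-P)|_{H\times H}$ be the Dirichlet Laplacian, with eigenvalues $\lambda_k(H)$ counted with multiplicity. Let $B_R(x_0)$ be the closed ball of the graph distance. 1. For every $x_0\in\mathbb Z^2$, every integer $R\ge 0$, $H=B_R(x_0)$, and each of the two walks: $\mathcal L_H$ is invertible, the series $G_H(x,y)$ ($x,y\in H$) converge to the entries of $\mathcal L_H^{-1}$, the eigenvalues $\lambda_k(H)$ are real and positive, and $Z_H(1)=\operatorname{tr}(\mathcal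 L_H^{-1})=\sum_k\lambda_k(H)^{-1}$. 2. For the LSRW the covariance matrix of a step is $\Sigma=\frac14 I_2$, so that $\frac1{2\pi\sqrt{\det\Sigma}}=\frac2\pi$, and the heat-kernel constant is $\mathcal G=\frac2\pi$: there are $\delta>0$, $C$ and $t_0$ such that $|p_t(x,x)-\mathcal G/t|\le C\,t^{-1-\delta}$ for all $x\in\mathbb Z^2$ and $t\ge t_0$. 3. For the SRW the covariance matrix of a step is $\Sigma=\frac12 I_2$, so that the constant $\mathcal G:=\frac1{2\pi\sqrt{\det\Sigma}}$ equals $\frac1\pi$. 4. Let $x_0\in\mathbb Z^2$, let $(R_n)$ be any sequence of nonnegative integers with $R_n\to\infty$, and put $G_n=B_{R_n}(x_0)$, $N_n=|G_n|$, $Z_n(1)=Z_{G_n}(1)$. Then $N_n\to\infty$. For the LSRW, $$\lim_{n\to\infty}\frac{Z_n(1)}{N_n\log N_n}=\frac2\pi,\qquad\text{equivalently}\qquad \pi=\lim_{n\to\infty}\frac{2N_n\log N_n}{Z_n(1)},$$ and for the SRW, $$\lim_{n\to\infty}\frac{Z_n(1)}{N_n\log N_n}=\frac1\pi .$$ -/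

import Mathlib

open Filter Topology
open scoped BigOperators

noncomputable section

namespace LatticeZeta

/-! ### Walks on graphs -/

section Walk

variable {V : Type*}

/-- One step of the simple random walk on `G` from `x`: a uniformly chosen neighbour of `x`. -/
def srwStep (G : SimpleGraph V) [G.LocallyFinite] [∀ x, Nonempty (G.neighborSet x)] (x : V) :
    PMF V :=
  (PMF.uniformOfFintype (G.neighborSet x)).map Subtype.val

/-- One step of the lazy simple random walk on `G` from `x`: toss a fair coin, stay at `x` on
`true`, and move to a uniformly chosen neighbour on `false`. -/
def lsrwStep (G : SimpleGraph V) [G.LocallyFinite] [∀ x, Nonempty (G.neighborSet x)] (x : V) :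
    PMF V :=
  (PMF.uniformOfFintype Bool).bind fun b => if b then PMF.pure x else srwStep G x

/-- The law of `(X_0, …, X_t)` for the Markov chain started at `x` whose step from `z` has
law `step z`. -/
def pathLaw (step : V → PMF V) (x : V) : (t : ℕ) → PMF (Fin (t + 1) → V)
  | 0 => PMF.pure fun _ => x
  | t + 1 => (pathLaw step x t).bind fun ω =>
      (step (ω (Fin.last t))).map fun y => Fin.snoc (α := fun _ => V) ω y

/-- The heat kernel `p_t(x, y) = ℙ_x[X_t = y]`. -/
def heatKernel (step : V → PMF V) (t : ℕ) (x y : V) : ℝ :=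
  ((pathLaw step x t).toOuterMeasure {ω | ω (Fin.last t) = y}).toReal

/-- The Dirichlet heat kernel `p_t^H(x, y) = ℙ_x[X_t = y, t < τ_H]`, where `τ_H` is the first time
at which the walk is outside `H`; so `t < τ_H` means that `X_0, …, X_t` all lie in `H`. -/
def dirichletHeatKernel (step : V → PMF V) (H : Finset V) (t : ℕ) (x y : V) : ℝ :=
  ((pathLaw step x t).toOuterMeasure {ω | ω (Fin.last t) = y ∧ ∀ s, ω s ∈ H}).toReal

/-- The Dirichlet Green function `G_H(x, y) = ∑_{t ≥ 0} p_t^H(x, y)`. -/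
def dirichletGreen (step : V → PMF V) (H : Finset V) (x y : V) : ℝ :=
  ∑' t : ℕ, dirichletHeatKernel step H t x y

/-- The zeta value `Z_H(1) = ∑_{x ∈ H} G_H(x, x)`. -/
def zetaOne (step : V → PMF V) (H : Finset V) : ℝ :=
  ∑ x ∈ H, dirichletGreen step H x x

/-- The Dirichlet Laplacian `I - P` restricted to `H × H`, where `P` is the transition matrix. -/
def dirichletLaplacian [DecidableEq V] (step : V → PMF V) (H : Finset V) : Matrix H H ℝ :=
  Matrix.of fun x y => (if x = y then 1 else 0) - (step x y).toReal

/-- The (real) eigenvalues of the Dirichlet Laplacian, with algebraic multiplicity. -/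
def dirichletEigenvalues [DecidableEq V] (step : V → PMF V) (H : Finset V) : Multiset ℝ :=
  (dirichletLaplacian step H).charpoly.roots

/-- On `H` the notions above are well defined and agree: the Dirichlet Laplacian `L_H` is
invertible, the series for the Green function converge to the entries of its inverse, all
eigenvalues of `L_H` are real and positive, and `Z_H(1) = tr (L_H⁻¹) = ∑_k λ_k⁻¹`. -/
def ZetaWellDefined [DecidableEq V] (step : V → PMF V) (H : Finset V) : Prop :=
  IsUnit (dirichletLaplacian step H).det ∧
  (∀ x y : H, HasSum (fun t : ℕ => dirichletHeatKernel step H t x y)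
    ((dirichletLaplacian step H)⁻¹ x y)) ∧
  Multiset.card (dirichletEigenvalues step H) = H.card ∧
  (∀ l ∈ dirichletEigenvalues step H, 0 < l) ∧
  zetaOne step H = ((dirichletLaplacian step H)⁻¹).trace ∧
  zetaOne step H = ((dirichletEigenvalues step H).map fun l => l⁻¹).sum

/-- `g` is the heat-kernel constant of the walk: `g > 0` and
`p_t(x, x) = g / t + O(t ^ (-1 - δ))` for some `δ > 0`, uniformly in `x`. -/
def IsHeatKernelConstant (step : V → PMF V) (g : ℝ) : Prop :=
  0 < g ∧ ∃ δ : ℝ, 0 < δ ∧ ∃ (t₀ : ℕ) (C : ℝ), ∀ (x : V) (t : ℕ), t₀ ≤ t →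
    |heatKernel step t x x - g / t| ≤ C * (t : ℝ) ^ (-1 - δ)

theorem finite_ball (G : SimpleGraph V) [G.LocallyFinite] (x : V) (R : ℕ) :
    {y | G.edist x y ≤ R}.Finite := by
  induction R with
  | zero =>
    refine (Set.finite_singleton x).subset fun y hy => ?_
    have h : y = x := by simpa using hy
    exact h
  | succ n ih =>
    refine ((ih.biUnion fun z _ => (G.neighborSet z).toFinite).union
      (Set.finite_singleton x)).subset fun y hy => ?_
    have hy' : G.edist x y ≤ ((n + 1 : ℕ) : ℕ∞) := hy
    have hne : G.edist x y ≠ ⊤ := ne_top_of_le_ne_top (ENat.natCast_ne_top _) hy'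
    obtain ⟨p, hp⟩ := SimpleGraph.exists_walk_of_edist_ne_top hne
    rw [← hp, Nat.cast_le, ← SimpleGraph.Walk.length_reverse] at hy'
    cases hq : p.reverse with
    | nil => exact Or.inr rfl
    | cons h q =>
      refine Or.inl (Set.mem_biUnion (x := _) ?_ h.symm)
      rw [hq, SimpleGraph.Walk.length_cons] at hy'
      have := SimpleGraph.Walk.edist_le q
      rw [SimpleGraph.edist_comm] at this
      exact this.trans (by exact_mod_cast Nat.le_of_succ_le_succ hy')

/-- The closed ball `B_R(x)` for the graph distance. -/
def ball (G : SimpleGraph V) [G.LocallyFinite] (x : V) (R : ℕ) : Finset V :=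
  (finite_ball G x R).toFinset

end Walk

/-! ### The square lattice -/

/-- The standard lattice `ℤ²`: two points are adjacent when their `ℓ¹`-distance is `1`. -/
def squareLattice : SimpleGraph (ℤ × ℤ) where
  Adj x y := |x.1 - y.1| + |x.2 - y.2| = 1
  symm := ⟨fun x y h => by rw [abs_sub_comm y.1, abs_sub_comm y.2]; exact h⟩
  loopless := ⟨fun x h => by simp at h⟩

theorem finite_neighborSet (x : ℤ × ℤ) : (squareLattice.neighborSet x).Finite := by
  refine (Set.finite_Icc (x.1 - 1, x.2 - 1) (x.1 + 1, x.2 + 1)).subset fun y hy => ?_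
  have h : |x.1 - y.1| + |x.2 - y.2| = 1 := hy
  have h1 := abs_le.mp (show |x.1 - y.1| ≤ 1 by have := abs_nonneg (x.2 - y.2); omega)
  have h2 := abs_le.mp (show |x.2 - y.2| ≤ 1 by have := abs_nonneg (x.1 - y.1); omega)
  exact ⟨⟨by simp only; omega, by simp only; omega⟩, ⟨by simp only; omega, by simp only; omega⟩⟩

instance : squareLattice.LocallyFinite := fun x => (finite_neighborSet x).fintype

instance (x : ℤ × ℤ) : Nonempty (squareLattice.neighborSet x) :=
  ⟨⟨(x.1 + 1, x.2), by simp [squareLattice]⟩⟩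

/-- The two coordinates on `ℤ²`, with real values. -/
def coord (i : Fin 2) (z : ℤ × ℤ) : ℝ := if i = 0 then (z.1 : ℝ) else (z.2 : ℝ)

/-- The covariance matrix of the increment `X_1 - X_0` of the walk started at `x`. -/
def stepCovariance (step : ℤ × ℤ → PMF (ℤ × ℤ)) (x : ℤ × ℤ) : Matrix (Fin 2) (Fin 2) ℝ :=
  Matrix.of fun i j =>
    ProbabilityTheory.covariance (fun z => coord i (z - x)) (fun z => coord j (z - x))
      (step x).toMeasure

/-- The constant `1 / (2 π √(det Σ))` of a planar step distribution with covariance matrix `Σ`. -/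
def covarianceConstant (S : Matrix (Fin 2) (Fin 2) ℝ) : ℝ :=
  1 / (2 * Real.pi * √S.det)

end LatticeZeta

end

open LatticeZeta

/-! In the rotated coordinates $u=y_1+y_2$, $v=y_1-y_2$ every lattice step changes both coordinates
by $\pm1$, with all four sign pairs equally likely. The simple walk is thus a product of two
independent walks on $\mathbb Z$ (`averaging_pow_single`), and the ball $B_R$ becomes the set of
points of one parity class in a square, whose sides are hit exactly when the walk leaves the ball.

Heat kernel. The return probability after $k$ moves is $(\binom{k}{k/2}2^{-k})^2$ for even $k$,
which Wallis' bounds put at $2/(\pi(k+1))$ up to $O(k^{-2})$. The number of moves of the lazy walk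
in $t$ steps is binomial, and the binomial average of the main term is exactly $2/(\pi(t+1))$
(`sum_choose_div_succ`).

Zeta values. With $M=2(R+1)$ and $\theta_j=\pi j/M$, the functions $\sin(\theta_j u)\sin(\theta_k
v)$ vanish on the sides of the square and are eigenvectors with eigenvalue
$\cos\theta_j\cos\theta_k$. The pairs $(j,k)$ and $(M-j,M-k)$ give the same function on the ball, so
the modes form a tight frame rather than a basis; completeness still inverts the Laplacian
(`srwStep_laplacian_inv`) and gives $2Z=1+\sum_{j,k}(1-\cos\theta_j\cos\theta_k)^{-1}$
(`zetaOne_srwStep`). For fixed $j$ the sum over $k$ is a Riemann sum of $\int_0^\pi dx/(1-c\cos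
x)=\pi/s$ with $c=\cos\theta_j$, $s=\sin\theta_j$, hence $M/s+O(s^{-2})$. Summing over $j$, the
terms $1/s$ give a harmonic sum, the errors only $O(R^2)$, so $Z\sim\frac4\pi R^2\log R$. Since
$N\log N\sim4R^2\log R$, the ratio tends to $1/\pi$. Laziness halves the Laplacian and so doubles
$Z$.

The positive mode $j=k=1$, with eigenvalue below $1$, makes the Green series converge; positivity of
the spectrum follows from that convergence. -/

namespace LatticeZeta

/-! ### Trajectories, killed walks and powers of the restricted transition matrix -/

section General

variable {V : Type*}

/-- The mass of the trajectories of length `t` from `x` to `y` which stay in `S`. -/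
noncomputable def killedMass (step : V → PMF V) (S : Set V) (t : ℕ) (x y : V) : ENNReal :=
  (pathLaw step x t).toOuterMeasure {ω | ω (Fin.last t) = y ∧ ∀ s, ω s ∈ S}

theorem killedMass_zero [DecidableEq V] (step : V → PMF V) (S : Set V) [DecidablePred (· ∈ S)]
    (x y : V) : killedMass step S 0 x y = if x = y ∧ x ∈ S then 1 else 0 := by
  unfold killedMass pathLaw
  rw [PMF.toOuterMeasure_pure_apply]
  simp

/-- Chapman–Kolmogorov for the killed walk: condition on the trajectory up to time `t`, then group
trajectories by their endpoint. Working in `ENNReal` makes the exchange of sums unconditional, and a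
general `S` serves both the free kernel (`Set.univ`) and the Dirichlet kernel. -/
theorem killedMass_succ (step : V → PMF V) (S : Set V) [DecidablePred (· ∈ S)] (t : ℕ) (x y : V) :
    killedMass step S (t + 1) x y =
      if y ∈ S then ∑' z, killedMass step S t x z * step z y else 0 := by
  classical
  have key : killedMass step S (t + 1) x y = ∑' ω, pathLaw step x t ω *
      (if (∀ s, ω s ∈ S) ∧ y ∈ S then step (ω (Fin.last t)) y else 0) := by
    unfold killedMass
    rw [pathLaw, PMF.toOuterMeasure_bind_apply]
    refine tsum_congr fun ω => ?_
    rw [PMF.toOuterMeasure_map_apply]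
    congr 1
    -- A trajectory has at most one admissible extension ending at `y`.
    have : ((fun y => Fin.snoc (α := fun _ => V) ω y) ⁻¹'
        {ω | ω (Fin.last (t + 1)) = y ∧ ∀ s, ω s ∈ S}) =
        if (∀ s, ω s ∈ S) ∧ y ∈ S then {y} else ∅ := by
      ext z
      simp only [Set.mem_preimage, Set.mem_ofPred_eq, Fin.snoc_last, Fin.forall_fin_succ',
        Fin.snoc_castSucc]
      split_ifs with h
      · simp only [Set.mem_singleton_iff]
        constructor
        · exact fun h => h.1
        · rintro rfl
          exact ⟨rfl, h⟩
      · simp only [Set.mem_empty_iff_false, iff_false]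
        rintro ⟨rfl, h'⟩
        exact h h'
    rw [this]
    split_ifs
    · rw [PMF.toOuterMeasure_apply_singleton]
    · simp
  rw [key]
  split_ifs with hy
  · have : ∀ z, killedMass step S t x z * step z y = ∑' ω, pathLaw step x t ω *
        (if ω (Fin.last t) = z ∧ (∀ s, ω s ∈ S) then step z y else 0) := by
      intro z
      unfold killedMass
      rw [PMF.toOuterMeasure_apply, ← ENNReal.tsum_mul_right]
      refine tsum_congr fun ω => ?_
      simp only [Set.indicator_apply, Set.mem_ofPred_eq]
      split_ifs <;> simp
    simp_rw [this]
    rw [ENNReal.tsum_comm]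
    refine tsum_congr fun ω => ?_
    rw [ENNReal.tsum_mul_left]
    congr 1
    rw [tsum_eq_single (ω (Fin.last t))]
    · simp [hy]
    · intro z hz
      rw [if_neg]
      exact fun h => hz h.1.symm
  · simp [hy]

theorem killedMass_ne_top (step : V → PMF V) (S : Set V) (t : ℕ) (x y : V) :
    killedMass step S t x y ≠ ⊤ := by
  refine ne_top_of_le_ne_top ENNReal.one_ne_top (?_ : _ ≤ (1 : ENNReal))
  unfold killedMass
  rw [← ((pathLaw step x t).toOuterMeasure_apply_eq_one_iff Set.univ).2 (Set.subset_univ _)]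
  exact MeasureTheory.measure_mono (Set.subset_univ _)

theorem killedMass_eq_zero_of_notMem (step : V → PMF V) (S : Set V) (t : ℕ) {x y : V}
    (hy : y ∉ S) : killedMass step S t x y = 0 := by
  unfold killedMass
  rw [show {ω : Fin (t + 1) → V | ω (Fin.last t) = y ∧ ∀ s, ω s ∈ S} = ∅ from ?_]
  · simp
  · ext ω
    simp only [Set.mem_ofPred_eq, Set.mem_empty_iff_false, iff_false]
    rintro ⟨rfl, h⟩
    exact hy (h _)

theorem heatKernel_eq_killedMass (step : V → PMF V) (t : ℕ) (x y : V) :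
    heatKernel step t x y = (killedMass step Set.univ t x y).toReal := by
  simp [heatKernel, killedMass]

theorem heatKernel_zero [DecidableEq V] (step : V → PMF V) (x y : V) :
    heatKernel step 0 x y = if x = y then 1 else 0 := by
  classical
  rw [heatKernel_eq_killedMass, killedMass_zero]
  by_cases h : x = y <;> simp [h]

theorem heatKernel_succ (step : V → PMF V) (t : ℕ) (x y : V) (A : Finset V)
    (hA : ∀ z, z ∉ A → step z y = 0) :
    heatKernel step (t + 1) x y = ∑ z ∈ A, heatKernel step t x z * (step z y).toReal := by
  classical
  simp_rw [heatKernel_eq_killedMass]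
  rw [killedMass_succ, if_pos (Set.mem_univ _), tsum_eq_sum (s := A), ENNReal.toReal_sum]
  · simp
  · exact fun z _ => ENNReal.mul_ne_top (killedMass_ne_top _ _ _ _ _) (PMF.apply_ne_top _ _)
  · intro z hz
    simp [hA z hz]

theorem dirichletHeatKernel_eq_killedMass (step : V → PMF V) (H : Finset V) (t : ℕ) (x y : V) :
    dirichletHeatKernel step H t x y = (killedMass step H t x y).toReal := by
  simp [dirichletHeatKernel, killedMass]

/-- The transition matrix restricted to `H`. -/
noncomputable def restrictedTransition (step : V → PMF V) (H : Finset V) : Matrix H H ℝ :=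
  Matrix.of fun x y => (step x y).toReal

/-- Points outside `H` carry no killed mass, so the recursion over all of `V` collapses to matrix
multiplication over `H`. -/
theorem dirichletHeatKernel_eq_pow [DecidableEq V] (step : V → PMF V) (H : Finset V) (t : ℕ)
    (x y : H) : dirichletHeatKernel step H t x y = (restrictedTransition step H ^ t) x y := by
  induction t generalizing y with
  | zero =>
    rw [dirichletHeatKernel_eq_killedMass, killedMass_zero, pow_zero, Matrix.one_apply]
    by_cases h : x = y <;> simp [h]
  | succ t ih =>
    rw [dirichletHeatKernel_eq_killedMass, killedMass_succ, if_pos (by simp),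
      tsum_eq_sum (s := H), ENNReal.toReal_sum, pow_succ, Matrix.mul_apply,
      ← Finset.sum_coe_sort H]
    · refine Finset.sum_congr rfl fun z _ => ?_
      rw [ENNReal.toReal_mul, ← dirichletHeatKernel_eq_killedMass, ih]
      rfl
    · exact fun z _ => ENNReal.mul_ne_top (killedMass_ne_top _ _ _ _ _) (PMF.apply_ne_top _ _)
    · intro z hz
      rw [killedMass_eq_zero_of_notMem _ _ _ (by simpa using hz), zero_mul]

theorem dirichletLaplacian_eq [DecidableEq V] (step : V → PMF V) (H : Finset V) :
    dirichletLaplacian step H = 1 - restrictedTransition step H := by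
  ext x y
  simp only [dirichletLaplacian, restrictedTransition, Matrix.of_apply, Matrix.sub_apply,
    Matrix.one_apply]

end General

/-! ### The steps of the two walks on the square lattice -/

/-- The four neighbours of a point of the square lattice. -/
def neighbours (x : ℤ × ℤ) : Finset (ℤ × ℤ) :=
  {(x.1 + 1, x.2), (x.1 - 1, x.2), (x.1, x.2 + 1), (x.1, x.2 - 1)}

theorem mem_neighbours {x y : ℤ × ℤ} : y ∈ neighbours x ↔ squareLattice.Adj x y := by
  obtain ⟨a, b⟩ := x
  obtain ⟨c, d⟩ := y
  simp only [neighbours, Finset.mem_insert, Finset.mem_singleton, Prod.mk.injEq, squareLattice]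
  constructor
  · rintro (⟨rfl, rfl⟩ | ⟨rfl, rfl⟩ | ⟨rfl, rfl⟩ | ⟨rfl, rfl⟩) <;> simp
  · intro h
    rcases abs_cases (a - c) with ⟨h1, h1'⟩ | ⟨h1, h1'⟩ <;>
    rcases abs_cases (b - d) with ⟨h2, h2'⟩ | ⟨h2, h2'⟩ <;> omega

theorem sum_neighbours {M : Type*} [AddCommMonoid M] (f : ℤ × ℤ → M) (x : ℤ × ℤ) :
    ∑ z ∈ neighbours x, f z =
      f (x.1 + 1, x.2) + (f (x.1 - 1, x.2) + (f (x.1, x.2 + 1) + f (x.1, x.2 - 1))) := by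
  unfold neighbours
  rw [Finset.sum_insert, Finset.sum_insert, Finset.sum_insert, Finset.sum_singleton]
  all_goals simp only [Finset.mem_insert, Finset.mem_singleton, Prod.mk.injEq]; omega

theorem card_neighborSet (x : ℤ × ℤ) : Fintype.card (squareLattice.neighborSet x) = 4 := by
  have h : (squareLattice.neighborSet x).toFinset = neighbours x := by
    ext y
    simp [mem_neighbours]
  rw [← Set.toFinset_card, h, Finset.card_eq_sum_ones, sum_neighbours]
  norm_num

theorem srwStep_apply (x y : ℤ × ℤ) :
    srwStep squareLattice x y = if y ∈ neighbours x then 4⁻¹ else 0 := by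
  classical
  unfold srwStep
  rw [PMF.map_apply]
  split_ifs with h
  · have h' : y ∈ squareLattice.neighborSet x := mem_neighbours.1 h
    rw [tsum_eq_single ⟨y, h'⟩]
    · rw [if_pos rfl, PMF.uniformOfFintype_apply, card_neighborSet]
      rfl
    · intro z hz
      rw [if_neg]
      rintro rfl
      exact hz rfl
  · refine ENNReal.tsum_eq_zero.2 fun z => ?_
    rw [if_neg]
    rintro rfl
    exact h (mem_neighbours.2 z.2)

theorem lsrwStep_apply (x y : ℤ × ℤ) :
    lsrwStep squareLattice x y =
      2⁻¹ * (if y = x then 1 else 0) + 2⁻¹ * srwStep squareLattice x y := by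
  unfold lsrwStep
  rw [PMF.bind_apply, tsum_fintype]
  simp [PMF.pure_apply]

theorem srwStep_toReal (x y : ℤ × ℤ) :
    (srwStep squareLattice x y).toReal = if y ∈ neighbours x then 1 / 4 else 0 := by
  rw [srwStep_apply]
  split_ifs <;> simp

theorem lsrwStep_toReal (x y : ℤ × ℤ) :
    (lsrwStep squareLattice x y).toReal =
      1 / 2 * (if y = x then 1 else 0) + 1 / 2 * (srwStep squareLattice x y).toReal := by
  rw [lsrwStep_apply, ENNReal.toReal_add, ENNReal.toReal_mul, ENNReal.toReal_mul]
  · split_ifs <;> simp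
  · split_ifs <;> simp
  · exact ENNReal.mul_ne_top (by simp) (PMF.apply_ne_top _ _)

/-! ### Covariances -/

theorem pmf_toMeasure_eq_sum (p : PMF (ℤ × ℤ)) (A : Finset (ℤ × ℤ)) (hA : ∀ z, z ∉ A → p z = 0) :
    p.toMeasure = ∑ z ∈ A, p z • MeasureTheory.Measure.dirac z := by
  ext s hs
  rw [PMF.toMeasure_apply _ hs, tsum_eq_sum (s := A)]
  · rw [MeasureTheory.Measure.finsetSum_apply]
    refine Finset.sum_congr rfl fun z _ => ?_
    by_cases h : z ∈ s <;> simp [MeasureTheory.Measure.dirac_apply' _ hs, h]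
  · intro z hz
    simp [hA z hz]

theorem integral_pmf_eq_sum (p : PMF (ℤ × ℤ)) (A : Finset (ℤ × ℤ)) (hA : ∀ z, z ∉ A → p z = 0)
    (f : ℤ × ℤ → ℝ) : ∫ z, f z ∂p.toMeasure = ∑ z ∈ A, (p z).toReal * f z := by
  rw [pmf_toMeasure_eq_sum p A hA, MeasureTheory.integral_finsetSum_measure]
  · refine Finset.sum_congr rfl fun z _ => ?_
    rw [MeasureTheory.integral_smul_measure, MeasureTheory.integral_dirac, smul_eq_mul]
  · intro z _
    exact (MeasureTheory.integrable_dirac (by simp)).smul_measure (PMF.apply_ne_top _ _)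

theorem integral_srwStep (x : ℤ × ℤ) (f : ℤ × ℤ → ℝ) :
    ∫ z, f z ∂(srwStep squareLattice x).toMeasure = (∑ z ∈ neighbours x, f z) / 4 := by
  rw [integral_pmf_eq_sum _ (neighbours x), Finset.sum_div]
  · refine Finset.sum_congr rfl fun z hz => ?_
    rw [srwStep_toReal, if_pos hz]
    ring
  · intro z hz
    rw [srwStep_apply, if_neg hz]

theorem notMem_neighbours_self (x : ℤ × ℤ) : x ∉ neighbours x := by
  rw [mem_neighbours]
  exact squareLattice.irrefl

theorem integral_lsrwStep (x : ℤ × ℤ) (f : ℤ × ℤ → ℝ) :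
    ∫ z, f z ∂(lsrwStep squareLattice x).toMeasure =
      f x / 2 + (∑ z ∈ neighbours x, f z) / 8 := by
  rw [integral_pmf_eq_sum _ (insert x (neighbours x)),
    Finset.sum_insert (notMem_neighbours_self x), Finset.sum_div]
  · congr 1
    · rw [lsrwStep_toReal, srwStep_toReal, if_neg (notMem_neighbours_self x)]
      simp
      ring
    · refine Finset.sum_congr rfl fun z hz => ?_
      rw [lsrwStep_toReal, srwStep_toReal, if_pos hz, if_neg]
      · ring
      · rintro rfl
        exact notMem_neighbours_self z hz
  · intro z hz
    rw [Finset.mem_insert, not_or] at hz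
    rw [lsrwStep_apply, srwStep_apply, if_neg hz.1, if_neg hz.2]
    simp

theorem stepCovariance_srwStep (x : ℤ × ℤ) :
    stepCovariance (srwStep squareLattice) x = (1 / 2 : ℝ) • 1 := by
  ext i j
  simp only [stepCovariance, Matrix.of_apply, ProbabilityTheory.covariance, integral_srwStep,
    sum_neighbours]
  fin_cases i <;> fin_cases j <;> simp [coord] <;> norm_num

theorem stepCovariance_lsrwStep (x : ℤ × ℤ) :
    stepCovariance (lsrwStep squareLattice) x = (1 / 4 : ℝ) • 1 := by
  ext i j
  simp only [stepCovariance, Matrix.of_apply, ProbabilityTheory.covariance, integral_lsrwStep,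
    sum_neighbours]
  fin_cases i <;> fin_cases j <;> simp [coord] <;> norm_num

theorem covarianceConstant_smul_one {a : ℝ} (ha : 0 ≤ a) :
    covarianceConstant (a • 1) = 1 / (2 * Real.pi * a) := by
  unfold covarianceConstant
  rw [Matrix.det_smul, Matrix.det_one, Fintype.card_fin, mul_one, Real.sqrt_sq ha]

/-! ### Return probabilities through rotated coordinates -/

theorem mem_neighbours_comm {x y : ℤ × ℤ} : y ∈ neighbours x ↔ x ∈ neighbours y := by
  rw [mem_neighbours, mem_neighbours, squareLattice.adj_comm]

/-- The averaging operator over the four neighbours. -/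
noncomputable def averaging : Module.End ℝ (ℤ × ℤ → ℝ) where
  toFun f y := (∑ z ∈ neighbours y, f z) / 4
  map_add' f g := by
    ext y
    simp [Finset.sum_add_distrib, add_div]
  map_smul' c f := by
    ext y
    simp [← Finset.mul_sum, mul_div_assoc]

theorem averaging_apply (f : ℤ × ℤ → ℝ) (y : ℤ × ℤ) :
    averaging f y = (∑ z ∈ neighbours y, f z) / 4 := rfl

/-- The transition probabilities of the simple random walk on `ℤ` started at `0`. -/
noncomputable def lineWalk : ℕ → ℤ → ℝ
  | 0, u => if u = 0 then 1 else 0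
  | k + 1, u => (lineWalk k (u - 1) + lineWalk k (u + 1)) / 2

theorem lineWalk_of_lt (k : ℕ) {u : ℤ} (hu : u < -k) : lineWalk k u = 0 := by
  induction k generalizing u with
  | zero =>
    rw [lineWalk, if_neg]
    rintro rfl
    simp at hu
  | succ k ih =>
    push_cast at hu
    rw [lineWalk, ih (by omega), ih (by omega)]
    simp

theorem lineWalk_of_odd (k : ℕ) {u : ℤ} (hu : Odd (u + k)) : lineWalk k u = 0 := by
  induction k generalizing u with
  | zero =>
    rw [lineWalk, if_neg]
    rintro rfl
    simp at hu
  | succ k ih =>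
    push_cast at hu
    rw [Int.odd_iff] at hu
    rw [lineWalk, ih (by rw [Int.odd_iff]; omega), ih (by rw [Int.odd_iff]; omega)]
    simp

/-- The site `2 * i - k` is reached by exactly `i` steps up; the recursion of the walk is Pascal's
rule. For `i = 0` one predecessor lies beyond the range of the walk. -/
theorem lineWalk_eq_choose (k i : ℕ) : lineWalk k (2 * i - k) = k.choose i / 2 ^ k := by
  induction k generalizing i with
  | zero =>
    cases i with
    | zero => simp [lineWalk]
    | succ i =>
      rw [lineWalk, if_neg (by push_cast; omega)]
      simp
  | succ k ih =>
    cases i with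
    | zero =>
      have h := ih 0
      rw [lineWalk, lineWalk_of_lt k (by push_cast; omega),
        show ((2 * (0 : ℕ) - (k + 1 : ℕ) + 1 : ℤ)) = 2 * (0 : ℕ) - k by push_cast; ring, h]
      simp only [Nat.choose_zero_right]
      ring
    | succ i =>
      rw [lineWalk, show ((2 * (i + 1 : ℕ) - (k + 1 : ℕ) - 1 : ℤ)) = 2 * i - k by push_cast; ring,
        show ((2 * (i + 1 : ℕ) - (k + 1 : ℕ) + 1 : ℤ)) = 2 * (i + 1 : ℕ) - k by push_cast; ring,
        ih, ih, Nat.choose_succ_succ]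
      push_cast
      ring

/-- The four steps realise the four sign pairs of increments of the rotated coordinates, so the
average over neighbours factors into two one-dimensional averages. -/
theorem averaging_pow_single (k : ℕ) (x y : ℤ × ℤ) :
    (averaging ^ k) (fun z => if x = z then 1 else 0) y =
      lineWalk k ((y.1 - x.1) + (y.2 - x.2)) * lineWalk k ((y.1 - x.1) - (y.2 - x.2)) := by
  induction k generalizing y with
  | zero =>
    simp only [pow_zero, Module.End.one_apply, lineWalk, Prod.ext_iff]
    split_ifs <;> first | omega | simp
  | succ k ih =>
    rw [pow_succ', Module.End.mul_apply, averaging_apply, sum_neighbours]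
    simp only [ih, lineWalk]
    rw [show y.1 + 1 - x.1 + (y.2 - x.2) = y.1 - x.1 + (y.2 - x.2) + 1 by ring,
      show y.1 + 1 - x.1 - (y.2 - x.2) = y.1 - x.1 - (y.2 - x.2) + 1 by ring,
      show y.1 - 1 - x.1 + (y.2 - x.2) = y.1 - x.1 + (y.2 - x.2) - 1 by ring,
      show y.1 - 1 - x.1 - (y.2 - x.2) = y.1 - x.1 - (y.2 - x.2) - 1 by ring,
      show y.1 - x.1 + (y.2 + 1 - x.2) = y.1 - x.1 + (y.2 - x.2) + 1 by ring,
      show y.1 - x.1 - (y.2 + 1 - x.2) = y.1 - x.1 - (y.2 - x.2) - 1 by ring,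
      show y.1 - x.1 + (y.2 - 1 - x.2) = y.1 - x.1 + (y.2 - x.2) - 1 by ring,
      show y.1 - x.1 - (y.2 - 1 - x.2) = y.1 - x.1 - (y.2 - x.2) + 1 by ring]
    ring

/-- The return probabilities of the simple random walk. -/
theorem averaging_pow_single_self (k : ℕ) (x : ℤ × ℤ) :
    (averaging ^ k) (fun z => if x = z then 1 else 0) x =
      if Even k then ((k.choose (k / 2) : ℝ) / 2 ^ k) ^ 2 else 0 := by
  rw [averaging_pow_single, sub_self, sub_self, add_zero, sub_zero]
  split_ifs with hk
  · rw [← lineWalk_eq_choose, sq]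
    have : (2 * ((k / 2 : ℕ) : ℤ) - k) = 0 := by
      obtain ⟨j, rfl⟩ := hk
      omega
    rw [this]
  · rw [lineWalk_of_odd, zero_mul]
    rw [Nat.not_even_iff_odd] at hk
    simpa using hk

/-- By symmetry of adjacency the sum over predecessors of `y` is an average over its neighbours. The
kernel becomes a power of an operator, to which the binomial theorem applies. -/
theorem heatKernel_lsrwStep (t : ℕ) (x : ℤ × ℤ) :
    heatKernel (lsrwStep squareLattice) t x =
      (((1 / 2 : ℝ) • (1 + averaging)) ^ t) (fun z => if x = z then 1 else 0) := by
  induction t with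
  | zero =>
    ext y
    rw [heatKernel_zero]
    simp
  | succ t ih =>
    ext y
    rw [heatKernel_succ _ t x y (insert y (neighbours y)),
      Finset.sum_insert (notMem_neighbours_self y), pow_succ', Module.End.mul_apply, ← ih]
    · simp only [LinearMap.smul_apply, LinearMap.add_apply, Module.End.one_apply, Pi.smul_apply,
        Pi.add_apply, averaging_apply, smul_eq_mul]
      rw [lsrwStep_toReal, srwStep_toReal, if_neg (notMem_neighbours_self y), if_pos rfl, mul_add (1 / 2 : ℝ),
        Finset.sum_div, Finset.mul_sum]
      congr 1
      · ring
      · refine Finset.sum_congr rfl fun z hz => ?_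
        rw [lsrwStep_toReal, srwStep_toReal, if_pos (mem_neighbours_comm.1 hz), if_neg]
        · ring
        · rintro rfl
          exact notMem_neighbours_self y hz
    · intro z hz
      rw [Finset.mem_insert, not_or] at hz
      rw [lsrwStep_apply, srwStep_apply, if_neg (fun h => hz.1 h.symm),
        if_neg (fun h => hz.2 (mem_neighbours_comm.1 h))]
      simp

/-- The index `k` counts the steps at which the lazy walk moves. -/
theorem heatKernel_lsrwStep_self (t : ℕ) (x : ℤ × ℤ) :
    heatKernel (lsrwStep squareLattice) t x x = ∑ k ∈ Finset.range (t + 1),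
      (t.choose k : ℝ) / 2 ^ t * if Even k then ((k.choose (k / 2) : ℝ) / 2 ^ k) ^ 2 else 0 := by
  rw [heatKernel_lsrwStep, smul_pow, add_comm, Commute.add_pow (Commute.one_right _)]
  simp only [LinearMap.smul_apply, LinearMap.sum_apply, one_pow, mul_one, Pi.smul_apply,
    Finset.sum_apply, smul_eq_mul, Finset.mul_sum]
  refine Finset.sum_congr rfl fun k _ => ?_
  rw [← averaging_pow_single_self k x, ← Nat.cast_comm, ← nsmul_eq_mul, LinearMap.smul_apply,
    Pi.smul_apply, nsmul_eq_mul, one_div, inv_pow]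
  ring

/-! ### Heat-kernel asymptotics of the lazy walk -/

/-- Wallis' bounds for the central binomial coefficient. -/
theorem abs_central_sub_le (j : ℕ) :
    |(((2 * j).choose j : ℝ) / 2 ^ (2 * j)) ^ 2 - 2 / (Real.pi * (2 * (j : ℝ) + 1))| ≤
      2 / ((2 * (j : ℝ) + 1) * (2 * (j : ℝ) + 2)) := by
  have hW : (((2 * j).choose j : ℝ) / 2 ^ (2 * j)) ^ 2 = 1 / (Real.Wallis.W j * (2 * j + 1)) := by
    rw [Real.Wallis.W_eq_factorial_ratio, two_mul, Nat.add_choose, ← two_mul,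
      Nat.cast_div (Nat.factorial_mul_factorial_dvd_factorial_add j j |>.trans (by rw [two_mul]))
        (by positivity)]
    have h1 : ((j.factorial : ℕ) : ℝ) ≠ 0 := by positivity
    have h2 : (((2 * j).factorial : ℕ) : ℝ) ≠ 0 := by positivity
    push_cast
    field_simp
    ring
  have hpi := Real.pi_pos
  have h1 := Real.Wallis.W_le j
  have h2 := Real.Wallis.le_W j
  have hp := Real.Wallis.W_pos j
  rw [hW]
  set a : ℝ := 2 * j + 1 with ha
  have ha1 : 1 ≤ a := by
    have : (0 : ℝ) ≤ j := by positivity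
    linarith
  rw [show (2 * j + 2 : ℝ) = a + 1 by rw [ha]; ring] at *
  have hlo : 2 / (Real.pi * a) ≤ 1 / (Real.Wallis.W j * a) := by
    rw [div_le_div_iff₀ (by positivity) (by positivity)]
    nlinarith
  have hhi : 1 / (Real.Wallis.W j * a) ≤ 2 * (a + 1) / (Real.pi * a ^ 2) := by
    rw [div_mul_eq_mul_div, div_le_iff₀ (by positivity)] at h2
    rw [div_le_div_iff₀ (by positivity) (by positivity)]
    nlinarith
  rw [abs_of_nonneg (by linarith)]
  have : 2 * (a + 1) / (Real.pi * a ^ 2) - 2 / (Real.pi * a) = 2 / (Real.pi * a ^ 2) := by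
    field_simp
    ring
  -- The loss is deliberate: with `k = 2 * j` the error takes the form `1 / ((k + 1) * (k + 2))`,
  -- which absorbs into binomial coefficients in `sum_choose_div_succ_succ_le`.
  have h3 : 2 / (Real.pi * a ^ 2) ≤ 2 / (a * (a + 1)) := by
    apply div_le_div_of_nonneg_left (by norm_num) (by positivity)
    nlinarith [Real.pi_gt_three]
  linarith

/-- Absorption turns $\binom tk/(k+1)$ into $\binom{t+1}{k+1}/(t+1)$, and the odd-index entries of
row `t + 1` add up to `2 ^ t`. The parity condition is encoded by $(1-(-1)^{k+1})/2$. -/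
theorem sum_choose_div_succ (t : ℕ) :
    ∑ k ∈ Finset.range (t + 1), (t.choose k : ℝ) / 2 ^ t * (if Even k then 1 / (k + 1 : ℝ) else 0) =
      1 / (t + 1) := by
  have h : ∀ k : ℕ, (t.choose k : ℝ) / 2 ^ t * (if Even k then 1 / (k + 1 : ℝ) else 0) =
      (((t + 1).choose (k + 1) : ℝ) - ((-1) ^ (k + 1) * (t + 1).choose (k + 1) : ℤ)) /
        (2 * 2 ^ t * (t + 1)) := by
    intro k
    have h1 : ((t + 1 : ℝ)) * t.choose k = (t + 1).choose (k + 1) * (k + 1) := by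
      exact_mod_cast Nat.add_one_mul_choose_eq t k
    have h2 : (t.choose k : ℝ) = (t + 1).choose (k + 1) * (k + 1) / (t + 1) := by
      field_simp
      linarith
    push_cast
    rw [h2]
    split_ifs with hk
    · rw [Odd.neg_one_pow (Even.add_one hk)]
      field_simp
      ring
    · rw [Even.neg_pow (Nat.even_add_one.2 hk), one_pow]
      simp
  simp_rw [h]
  rw [← Finset.sum_div, Finset.sum_sub_distrib, ← Nat.cast_sum, ← Int.cast_sum]
  have e1 := Nat.sum_range_choose (t + 1)
  have e2 := Int.alternating_sum_range_choose (n := t + 1)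
  rw [Finset.sum_range_succ'] at e1 e2
  have e1' : ((∑ i ∈ Finset.range (t + 1), (t + 1).choose (i + 1) : ℕ) : ℝ) = 2 ^ (t + 1) - 1 := by
    rw [eq_sub_iff_add_eq]
    exact_mod_cast e1
  have e2' : ((∑ i ∈ Finset.range (t + 1), (-1) ^ (i + 1) * ((t + 1).choose (i + 1) : ℤ) : ℤ) : ℝ) =
      - 1 := by
    have : (∑ i ∈ Finset.range (t + 1), (-1) ^ (i + 1) * ((t + 1).choose (i + 1) : ℤ) : ℤ) = - 1 := by
      simp only [Nat.choose_zero_right, pow_zero, Nat.add_eq_zero_iff, one_ne_zero, and_false,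
        if_false] at e2
      push_cast at e2
      linarith
    rw [this]
    simp
  rw [e1', e2']
  field_simp
  ring

/-- Absorbing twice leaves part of row `t + 2` of Pascal's triangle, at most `2 ^ (t + 2)`. -/
theorem sum_choose_div_succ_succ_le (t : ℕ) :
    ∑ k ∈ Finset.range (t + 1), (t.choose k : ℝ) / 2 ^ t * (1 / ((k + 1) * (k + 2))) ≤
      4 / ((t + 1) * (t + 2)) := by
  have h : ∀ k : ℕ, (t.choose k : ℝ) / 2 ^ t * (1 / ((k + 1) * (k + 2))) =
      ((t + 2).choose (k + 2) : ℝ) / (2 ^ t * ((t + 1) * (t + 2))) := by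
    intro k
    have h1 : ((t + 1 : ℝ)) * t.choose k = (t + 1).choose (k + 1) * (k + 1) := by
      exact_mod_cast Nat.add_one_mul_choose_eq t k
    have h2 : ((t + 2 : ℝ)) * (t + 1).choose (k + 1) = (t + 2).choose (k + 2) * (k + 2) := by
      exact_mod_cast Nat.add_one_mul_choose_eq (t + 1) (k + 1)
    rw [div_mul_div_comm, mul_one, div_eq_div_iff (by positivity) (by positivity)]
    linear_combination (2 ^ t * (t + 2) : ℝ) * h1 + (2 ^ t * (k + 1) : ℝ) * h2
  simp_rw [h]
  rw [← Finset.sum_div, ← Nat.cast_sum]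
  have e1 := Nat.sum_range_choose (t + 2)
  rw [Finset.sum_range_succ', Finset.sum_range_succ'] at e1
  have : ((∑ i ∈ Finset.range (t + 1), (t + 2).choose (i + 2) : ℕ) : ℝ) ≤ 2 ^ (t + 2) := by
    rw [show (2 : ℝ) ^ (t + 2) = ((2 ^ (t + 2) : ℕ) : ℝ) by push_cast; ring, ← e1]
    push_cast
    have := Nat.cast_nonneg (α := ℝ) ((t + 2).choose (0 + 1))
    have := Nat.cast_nonneg (α := ℝ) ((t + 2).choose 0)
    linarith
  rw [div_le_div_iff₀ (by positivity) (by positivity)]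
  have h4 : (0 : ℝ) ≤ (t + 1) * (t + 2) := by positivity
  rw [show (4 : ℝ) * (2 ^ t * ((t + 1) * (t + 2))) = 2 ^ (t + 2) * ((t + 1) * (t + 2)) by ring]
  exact mul_le_mul_of_nonneg_right this h4

theorem abs_heatKernel_lsrwStep_sub_le (t : ℕ) (x : ℤ × ℤ) :
    |heatKernel (lsrwStep squareLattice) t x x - 2 / Real.pi * (1 / (t + 1))| ≤
      8 / ((t + 1) * (t + 2)) := by
  rw [heatKernel_lsrwStep_self, ← sum_choose_div_succ t, Finset.mul_sum, ← Finset.sum_sub_distrib]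
  refine (Finset.abs_sum_le_sum_abs _ _).trans ?_
  have h : ∀ k ∈ Finset.range (t + 1), |(t.choose k : ℝ) / 2 ^ t *
      (if Even k then ((k.choose (k / 2) : ℝ) / 2 ^ k) ^ 2 else 0) -
      2 / Real.pi * ((t.choose k : ℝ) / 2 ^ t * (if Even k then 1 / (k + 1 : ℝ) else 0))| ≤
      2 * ((t.choose k : ℝ) / 2 ^ t * (1 / ((k + 1) * (k + 2)))) := by
    intro k _
    split_ifs with hk
    · obtain ⟨j, rfl⟩ := hk
      rw [← two_mul, show 2 * j / 2 = j by omega]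
      have := abs_central_sub_le j
      have e : ∀ a b c : ℝ, a * b - 2 / Real.pi * (a * (1 / c)) = a * (b - 2 / (Real.pi * c)) := by
        intro a b c
        rw [div_mul_eq_div_div]
        ring
      push_cast
      rw [e, abs_mul, abs_of_nonneg (by positivity), mul_left_comm]
      refine mul_le_mul_of_nonneg_left (this.trans (le_of_eq ?_)) (by positivity)
      ring
    · simp
      positivity
  refine (Finset.sum_le_sum h).trans ?_
  rw [← Finset.mul_sum]
  refine (mul_le_mul_of_nonneg_left (sum_choose_div_succ_succ_le t) (by norm_num)).trans
    (le_of_eq ?_)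
  ring

theorem isHeatKernelConstant_lsrwStep :
    IsHeatKernelConstant (lsrwStep squareLattice) (2 / Real.pi) := by
  -- Here `δ = 1`, and the constant is `8 + 1`: `8` from the Wallis error, `1` from replacing `1 /
  -- (t + 1)` by `1 / t`.
  refine ⟨by positivity, 1, one_pos, 1, 9, fun x t ht => ?_⟩
  have ht' : (1 : ℝ) ≤ t := by exact_mod_cast ht
  have h := abs_heatKernel_lsrwStep_sub_le t x
  have e : (t : ℝ) ^ (-1 - 1 : ℝ) = 1 / (t : ℝ) ^ 2 := by
    rw [show (-1 - 1 : ℝ) = -(2 : ℕ) by norm_num, Real.rpow_neg (by positivity), Real.rpow_natCast,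
      one_div]
  rw [e]
  have h1 : 8 / ((t + 1) * (t + 2)) ≤ 8 * (1 / (t : ℝ) ^ 2) := by
    rw [mul_one_div]
    exact div_le_div_of_nonneg_left (by norm_num) (by positivity) (by nlinarith)
  have h2 : |2 / Real.pi * (1 / (t + 1)) - 2 / Real.pi / t| ≤ 1 / (t : ℝ) ^ 2 := by
    have : 2 / Real.pi * (1 / (t + 1)) - 2 / Real.pi / t = - (2 / Real.pi * (1 / (t * (t + 1)))) := by
      field_simp
      ring
    rw [this, abs_neg, abs_of_nonneg (by positivity)]
    have hp : 2 / Real.pi ≤ 1 := by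
      rw [div_le_one Real.pi_pos]
      linarith [Real.pi_gt_three]
    have : 1 / (t * (t + 1)) ≤ 1 / (t : ℝ) ^ 2 :=
      div_le_div_of_nonneg_left (by norm_num) (by positivity) (by nlinarith)
    calc _ ≤ 1 * (1 / (t * (t + 1)) : ℝ) := by gcongr
      _ ≤ _ := by rw [one_mul]; exact this
  have := abs_sub_le (heatKernel (lsrwStep squareLattice) t x x) (2 / Real.pi * (1 / (t + 1)))
    (2 / Real.pi / t)
  linarith

/-! ### Geometric series of substochastic matrices -/

section Contraction

variable {ι : Type*} [Fintype ι] [DecidableEq ι]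

theorem pow_mulVec_eigenvector {Q : Matrix ι ι ℝ} {h : ι → ℝ} {r : ℝ}
    (hQ : Q.mulVec h = r • h) (t : ℕ) : (Q ^ t).mulVec h = r ^ t • h := by
  induction t with
  | zero => simp
  | succ t ih =>
    rw [pow_succ, ← Matrix.mulVec_mulVec, hQ, Matrix.mulVec_smul, ih, smul_smul, pow_succ']

theorem pow_apply_nonneg {Q : Matrix ι ι ℝ} (hQ : ∀ x y, 0 ≤ Q x y) (t : ℕ) (x y : ι) :
    0 ≤ (Q ^ t) x y := by
  induction t generalizing x y with
  | zero =>
    rw [pow_zero, Matrix.one_apply]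
    split_ifs <;> simp
  | succ t ih =>
    rw [pow_succ, Matrix.mul_apply]
    exact Finset.sum_nonneg fun z _ => mul_nonneg (ih x z) (hQ z y)

/-- A positive eigenvector dominates: $Q^t(x,y)h(y)\le(Q^th)(x)=r^th(x)$, a geometric bound. -/
theorem summable_pow_apply {Q : Matrix ι ι ℝ} (h0 : ∀ x y, 0 ≤ Q x y) {h : ι → ℝ}
    (hpos : ∀ x, 0 < h x) {r : ℝ} (hr0 : 0 ≤ r) (hr : r < 1) (hQ : Q.mulVec h = r • h) (x y : ι) :
    Summable fun t : ℕ => (Q ^ t) x y := by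
  refine Summable.of_nonneg_of_le (fun t => pow_apply_nonneg h0 t x y) (fun t => ?_)
    ((summable_geometric_of_lt_one hr0 hr).mul_right (h x / h y))
  have h1 := congrFun (pow_mulVec_eigenvector hQ t) x
  have h2 : (Q ^ t) x y * h y ≤ ∑ z, (Q ^ t) x z * h z :=
    Finset.single_le_sum (f := fun z => (Q ^ t) x z * h z)
      (fun z _ => mul_nonneg (pow_apply_nonneg h0 t x z) (hpos z).le) (Finset.mem_univ y)
  have h3 : ∑ z, (Q ^ t) x z * h z = r ^ t * h x := h1
  rw [← mul_div_assoc, le_div_iff₀ (hpos y)]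
  linarith

/-- Neumann series, entry by entry: shifting the index gives $S=1+QS$. -/
theorem geometric_inverse {Q : Matrix ι ι ℝ}
    (hs : ∀ x y, Summable fun t : ℕ => (Q ^ t) x y) :
    IsUnit (1 - Q).det ∧ ∀ x y, HasSum (fun t : ℕ => (Q ^ t) x y) ((1 - Q)⁻¹ x y) := by
  set S : Matrix ι ι ℝ := Matrix.of fun x y => ∑' t : ℕ, (Q ^ t) x y with hS
  have hsum : ∀ x y, HasSum (fun t : ℕ => (Q ^ t) x y) (S x y) := fun x y => (hs x y).hasSum
  have h1 : (1 - Q) * S = 1 := by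
    have h2 : S = 1 + Q * S := by
      ext x y
      have e1 : HasSum (fun t : ℕ => (Q ^ (t + 1)) x y) ((Q * S) x y) := by
        simp_rw [pow_succ', Matrix.mul_apply]
        exact hasSum_sum fun z _ => (hsum z y).mul_left (Q x z)
      have e2 := (hasSum_nat_add_iff (f := fun t : ℕ => (Q ^ t) x y) 1).1 e1
      rw [(hsum x y).unique e2]
      simp [add_comm]
    rw [sub_mul, one_mul]
    nth_rw 1 [h2]
    simp
  refine ⟨Matrix.isUnit_det_of_right_inverse h1, fun x y => ?_⟩
  rw [Matrix.inv_eq_right_inv h1]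
  exact hsum x y

theorem trace_inv_eq_sum_eigenvalues {A : Matrix ι ι ℝ} (hA : A.IsHermitian)
    (hpos : ∀ i, 0 < hA.eigenvalues i) : A⁻¹.trace = ∑ i, (hA.eigenvalues i)⁻¹ := by
  set U : Matrix ι ι ℝ := (hA.eigenvectorUnitary : Matrix ι ι ℝ) with hU
  have hUU : U * star U = 1 := by simp [hU]
  have hUU' : star U * U = 1 := by simp [hU]
  have hspec : A = U * Matrix.diagonal hA.eigenvalues * star U := by
    conv_lhs => rw [hA.spectral_theorem]
    rw [Unitary.conjStarAlgAut_apply]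
    rfl
  have hinv : A⁻¹ = U * Matrix.diagonal (fun i => (hA.eigenvalues i)⁻¹) * star U := by
    apply Matrix.inv_eq_right_inv
    calc A * (U * Matrix.diagonal (fun i => (hA.eigenvalues i)⁻¹) * star U) =
          U * Matrix.diagonal hA.eigenvalues * star U *
          (U * Matrix.diagonal (fun i => (hA.eigenvalues i)⁻¹) * star U) :=
          congrArg (· * (U * Matrix.diagonal (fun i => (hA.eigenvalues i)⁻¹) * star U)) hspec
      _ = U * Matrix.diagonal hA.eigenvalues * (star U * U) *
          Matrix.diagonal (fun i => (hA.eigenvalues i)⁻¹) * star U := by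
          simp only [mul_assoc]
      _ = 1 := by
        rw [hUU', mul_one, mul_assoc U, Matrix.diagonal_mul_diagonal]
        simp_rw [fun i => mul_inv_cancel₀ (hpos i).ne']
        rw [Matrix.diagonal_one, mul_one, hUU]
  rw [hinv, Matrix.trace_mul_comm, ← mul_assoc, hUU', one_mul, Matrix.trace_diagonal]

end Contraction

/-! ### Green function, trace and eigenvalues -/

section General

variable {V : Type*} [DecidableEq V]

theorem zetaOne_eq_trace (step : V → PMF V) (H : Finset V)
    (hs : ∀ x y, Summable fun t : ℕ => (restrictedTransition step H ^ t) x y) :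
    zetaOne step H = ((dirichletLaplacian step H)⁻¹).trace := by
  rw [dirichletLaplacian_eq, zetaOne, ← Finset.sum_coe_sort H, Matrix.trace]
  refine Finset.sum_congr rfl fun x _ => ?_
  rw [dirichletGreen]
  simp_rw [dirichletHeatKernel_eq_pow]
  exact ((geometric_inverse hs).2 x x).tsum_eq

theorem zetaWellDefined_of_summable (step : V → PMF V) (H : Finset V)
    (hsymm : ∀ x y, step x y = step y x)
    (hs : ∀ x y, Summable fun t : ℕ => (restrictedTransition step H ^ t) x y) :
    ZetaWellDefined step H := by
  set Q := restrictedTransition step H with hQ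
  have hL : dirichletLaplacian step H = 1 - Q := dirichletLaplacian_eq step H
  have hherm : (1 - Q).IsHermitian := by
    refine Matrix.isHermitian_one.sub ?_
    ext x y
    simp [hQ, restrictedTransition, hsymm x y]
  obtain ⟨hdet, hsum⟩ := geometric_inverse hs
  have hroots : dirichletEigenvalues step H = Multiset.map hherm.eigenvalues Finset.univ.val := by
    rw [dirichletEigenvalues, hL, hherm.roots_charpoly_eq_eigenvalues]
    rfl
  -- On an eigenvector $f$ for $\lambda$ one has $Q^tf=(1-\lambda)^tf$. Summability forces
  -- $Q^t\to0$, so $|1-\lambda|<1$.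
  have hpos : ∀ i, 0 < hherm.eigenvalues i := by
    intro i
    set f : H → ℝ := WithLp.ofLp (hherm.eigenvectorBasis i) with hf
    have h1 : (1 - Q).mulVec f = hherm.eigenvalues i • f := hherm.mulVec_eigenvectorBasis i
    have h2 : Q.mulVec f = (1 - hherm.eigenvalues i) • f := by
      rw [Matrix.sub_mulVec, Matrix.one_mulVec] at h1
      rw [sub_smul, one_smul, ← h1, sub_sub_cancel]
    have hf0 : f ≠ 0 := by
      intro h0
      apply hherm.eigenvectorBasis.orthonormal.ne_zero i
      ext x
      exact congrFun h0 x
    obtain ⟨x, hx⟩ := Function.ne_iff.1 hf0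
    have h3 : Tendsto (fun t : ℕ => (1 - hherm.eigenvalues i) ^ t * f x) atTop (𝓝 0) := by
      have h4 : Tendsto (fun t : ℕ => ∑ z, (Q ^ t) x z * f z) atTop (𝓝 (∑ z : H, 0 * f z)) :=
        tendsto_finsetSum _ fun z _ => (hs x z).tendsto_atTop_zero.mul_const _
      simp only [zero_mul, Finset.sum_const_zero] at h4
      refine h4.congr fun t => ?_
      exact congrFun (pow_mulVec_eigenvector h2 t) x
    have h5 : Tendsto (fun t : ℕ => (1 - hherm.eigenvalues i) ^ t) atTop (𝓝 0) := by
      have := h3.mul_const (f x)⁻¹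
      rw [zero_mul] at this
      refine this.congr fun t => ?_
      rw [mul_assoc, mul_inv_cancel₀ hx, mul_one]
    have := (abs_lt.1 (tendsto_pow_atTop_nhds_zero_iff.1 h5)).2
    linarith
  have htr := zetaOne_eq_trace step H hs
  refine ⟨by rwa [hL], fun x y => ?_, ?_, ?_, htr, ?_⟩
  · rw [hL]
    simp_rw [dirichletHeatKernel_eq_pow]
    exact hsum x y
  · rw [hroots, Multiset.card_map, Finset.card_val, Finset.card_univ, Fintype.card_coe]
  · rw [hroots]
    intro l hl
    obtain ⟨i, _, rfl⟩ := Multiset.mem_map.1 hl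
    exact hpos i
  · rw [htr, hL, trace_inv_eq_sum_eigenvalues hherm hpos, hroots, Multiset.map_map]
    rfl

end General

/-! ### Balls of the square lattice -/

theorem abs_sub_le_length {x y : ℤ × ℤ} (p : squareLattice.Walk x y) :
    |y.1 - x.1| + |y.2 - x.2| ≤ p.length := by
  induction p with
  | nil => simp
  | @cons a b c h p ih =>
    have h1 : |a.1 - b.1| + |a.2 - b.2| = 1 := h
    rw [SimpleGraph.Walk.length_cons]
    push_cast
    have h2 := abs_sub_le c.1 b.1 a.1
    have h3 := abs_sub_le c.2 b.2 a.2
    rw [abs_sub_comm b.1] at h2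
    rw [abs_sub_comm b.2] at h3
    linarith

theorem edist_le_of_abs_sub_le (n : ℕ) (x y : ℤ × ℤ) (h : |y.1 - x.1| + |y.2 - x.2| ≤ n) :
    squareLattice.edist x y ≤ n := by
  induction n generalizing y with
  | zero =>
    have h1 := abs_nonneg (y.1 - x.1)
    have h2 := abs_nonneg (y.2 - x.2)
    have h3 : y = x := by
      push_cast at h
      ext
      · exact sub_eq_zero.1 (abs_eq_zero.1 (by omega))
      · exact sub_eq_zero.1 (abs_eq_zero.1 (by omega))
    simp [h3]
  | succ n ih =>
    by_cases hn : |y.1 - x.1| + |y.2 - x.2| ≤ n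
    · exact (ih y hn).trans (by exact_mod_cast Nat.le_succ n)
    · have : ∃ z ∈ neighbours y, |z.1 - x.1| + |z.2 - x.2| ≤ n := by
        push_cast at h hn
        simp only [neighbours, Finset.mem_insert, Finset.mem_singleton, exists_eq_or_imp,
          exists_eq_left]
        -- Move towards `x` in the first coordinate if it differs, otherwise in the second; both
        -- agreeing would contradict `hn`.
        rcases lt_trichotomy y.1 x.1 with h1 | h1 | h1
        · left
          rw [abs_of_nonpos (by omega)] at h ⊢
          omega
        · right; right
          rcases lt_trichotomy y.2 x.2 with h2 | h2 | h2
          · left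
            rw [abs_of_nonpos (by omega : y.2 - x.2 ≤ 0)] at h
            rw [abs_of_nonpos (by omega : y.2 + 1 - x.2 ≤ 0)]
            omega
          · rw [h1, h2] at hn
            simp only [sub_self, abs_zero, add_zero] at hn
            omega
          · right
            rw [abs_of_nonneg (by omega : 0 ≤ y.2 - x.2)] at h
            rw [abs_of_nonneg (by omega : 0 ≤ y.2 - 1 - x.2)]
            omega
        · right; left
          rw [abs_of_nonneg (by omega : 0 ≤ y.1 - x.1)] at h
          rw [abs_of_nonneg (by omega : 0 ≤ y.1 - 1 - x.1)]
          omega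
      obtain ⟨z, hz, hzn⟩ := this
      obtain hz := (mem_neighbours.1 hz).symm
      calc squareLattice.edist x y ≤ squareLattice.edist x z + squareLattice.edist z y :=
            SimpleGraph.edist_triangle
        _ ≤ n + 1 := by
            gcongr
            · exact ih z hzn
            · exact (SimpleGraph.edist_eq_one_iff_adj.2 hz).le
        _ = _ := by push_cast; rfl

theorem mem_ball_iff {x y : ℤ × ℤ} {R : ℕ} :
    y ∈ ball squareLattice x R ↔ |y.1 - x.1| + |y.2 - x.2| ≤ R := by
  rw [ball, Set.Finite.mem_toFinset]
  constructor
  · intro h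
    have h : squareLattice.edist x y ≤ R := h
    obtain ⟨p, hp⟩ := SimpleGraph.exists_walk_of_edist_ne_top
      (ne_top_of_le_ne_top (ENat.natCast_ne_top R) h)
    rw [← hp, Nat.cast_le] at h
    exact (abs_sub_le_length p).trans (by exact_mod_cast h)
  · exact edist_le_of_abs_sub_le R x y

/-- The rotated coordinate `y₁ + y₂`, shifted so that it runs over `(0, 2 (R + 1))` on the ball. -/
def coordSum (x : ℤ × ℤ) (R : ℕ) (y : ℤ × ℤ) : ℤ := (y.1 - x.1) + (y.2 - x.2) + (R + 1)

/-- The rotated coordinate `y₁ - y₂`, shifted so that it runs over `(0, 2 (R + 1))` on the ball. -/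
def coordDiff (x : ℤ × ℤ) (R : ℕ) (y : ℤ × ℤ) : ℤ := (y.1 - x.1) - (y.2 - x.2) + (R + 1)

/-- $|a|+|b|\le R$ iff $|a+b|\le R$ and $|a-b|\le R$: the diamond is a square in rotated
coordinates. -/
theorem mem_ball_iff_coord {x y : ℤ × ℤ} {R : ℕ} :
    y ∈ ball squareLattice x R ↔ (0 < coordSum x R y ∧ coordSum x R y < 2 * (R + 1)) ∧
      (0 < coordDiff x R y ∧ coordDiff x R y < 2 * (R + 1)) := by
  rw [mem_ball_iff]
  unfold coordSum coordDiff
  grind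

/-- Rotated coordinates change by exactly `1`, so an exit lands on a side of the square and never
jumps over it. -/
theorem coord_of_mem_neighbours_of_notMem_ball {x y z : ℤ × ℤ} {R : ℕ}
    (hy : y ∈ ball squareLattice x R) (hz : z ∈ neighbours y) (hzb : z ∉ ball squareLattice x R) :
    (coordSum x R z = 0 ∨ coordSum x R z = 2 * (R + 1)) ∨
      (coordDiff x R z = 0 ∨ coordDiff x R z = 2 * (R + 1)) := by
  rw [mem_ball_iff_coord] at hy hzb
  simp only [neighbours, Finset.mem_insert, Finset.mem_singleton] at hz
  unfold coordSum coordDiff at *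
  rcases hz with rfl | rfl | rfl | rfl <;> dsimp only at * <;> omega

/-- The angle `π j / (2 (R + 1))`. -/
noncomputable def angle (R j : ℕ) : ℝ := Real.pi * j / (2 * (R + 1))

/-- The function `sin (θ_j u) sin (θ_k v)` in the rotated coordinates. -/
noncomputable def mode (x : ℤ × ℤ) (R j k : ℕ) (y : ℤ × ℤ) : ℝ :=
  Real.sin (angle R j * coordSum x R y) * Real.sin (angle R k * coordDiff x R y)

/-- The average factors, and $\sin(ap+a)+\sin(ap-a)=2\cos a\,\sin(ap)$ in each factor. -/
theorem averaging_mode (x : ℤ × ℤ) (R j k : ℕ) (y : ℤ × ℤ) :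
    averaging (mode x R j k) y = Real.cos (angle R j) * Real.cos (angle R k) * mode x R j k y := by
  rw [averaging_apply, sum_neighbours]
  simp only [mode, coordSum, coordDiff]
  push_cast
  set a := angle R j
  set b := angle R k
  set p : ℝ := y.1 - x.1 + (y.2 - x.2) + (R + 1)
  set q : ℝ := y.1 - x.1 - (y.2 - x.2) + (R + 1)
  rw [show a * ((y.1 : ℝ) + 1 - x.1 + (y.2 - x.2) + (R + 1)) = a * p + a by ring,
    show b * ((y.1 : ℝ) + 1 - x.1 - (y.2 - x.2) + (R + 1)) = b * q + b by ring,
    show a * ((y.1 : ℝ) - 1 - x.1 + (y.2 - x.2) + (R + 1)) = a * p - a by ring,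
    show b * ((y.1 : ℝ) - 1 - x.1 - (y.2 - x.2) + (R + 1)) = b * q - b by ring,
    show a * ((y.1 : ℝ) - x.1 + (y.2 + 1 - x.2) + (R + 1)) = a * p + a by ring,
    show b * ((y.1 : ℝ) - x.1 - (y.2 + 1 - x.2) + (R + 1)) = b * q - b by ring,
    show a * ((y.1 : ℝ) - x.1 + (y.2 - 1 - x.2) + (R + 1)) = a * p - a by ring,
    show b * ((y.1 : ℝ) - x.1 - (y.2 - 1 - x.2) + (R + 1)) = b * q + b by ring]
  simp only [Real.sin_add, Real.sin_sub]
  ring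

theorem sin_angle_mul_end (R j : ℕ) : Real.sin (angle R j * (2 * (R + 1))) = 0 := by
  have h : (2 * ((R : ℝ) + 1)) ≠ 0 := by positivity
  rw [angle, div_mul_cancel₀ _ h, mul_comm]
  exact Real.sin_nat_mul_pi j

theorem mode_eq_zero_of_notMem_ball {x y z : ℤ × ℤ} {R : ℕ} (j k : ℕ)
    (hy : y ∈ ball squareLattice x R) (hz : z ∈ neighbours y) (hzb : z ∉ ball squareLattice x R) :
    mode x R j k z = 0 := by
  unfold mode
  rcases coord_of_mem_neighbours_of_notMem_ball hy hz hzb with (h | h) | (h | h) <;> rw [h]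
  · simp
  · push_cast
    rw [sin_angle_mul_end, zero_mul]
  · simp
  · push_cast
    rw [sin_angle_mul_end, mul_zero]

/-- Killing drops the neighbours outside `H`, which costs nothing when `f` vanishes there. -/
theorem restrictedTransition_srwStep_mulVec {H : Finset (ℤ × ℤ)} {f : ℤ × ℤ → ℝ}
    (hf : ∀ y ∈ H, ∀ z ∈ neighbours y, z ∉ H → f z = 0) (y : H) :
    (restrictedTransition (srwStep squareLattice) H).mulVec (fun z => f z) y = averaging f y := by
  have h1 : (restrictedTransition (srwStep squareLattice) H).mulVec (fun z => f z) y =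
      ∑ z ∈ H, (if z ∈ neighbours y then f z / 4 else 0) := by
    rw [← Finset.sum_coe_sort H]
    refine Finset.sum_congr rfl fun z _ => ?_
    change (srwStep squareLattice y z).toReal * f z = _
    rw [srwStep_toReal]
    split_ifs <;> ring
  rw [h1, averaging_apply, Finset.sum_div, ← Finset.sum_filter, Finset.filter_mem_eq_inter]
  refine Finset.sum_subset Finset.inter_subset_right fun z hz hzn => ?_
  rw [hf y y.2 z hz, zero_div]
  exact fun h => hzn (Finset.mem_inter.2 ⟨h, hz⟩)

theorem srwStep_mulVec_mode (x : ℤ × ℤ) (R j k : ℕ) :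
    (restrictedTransition (srwStep squareLattice) (ball squareLattice x R)).mulVec
      (fun z => mode x R j k z) =
      (Real.cos (angle R j) * Real.cos (angle R k)) •
        fun z : ball squareLattice x R => mode x R j k z := by
  ext y
  rw [restrictedTransition_srwStep_mulVec (fun y hy z => mode_eq_zero_of_notMem_ball j k hy),
    averaging_mode]
  rfl

theorem restrictedTransition_lsrwStep (H : Finset (ℤ × ℤ)) :
    restrictedTransition (lsrwStep squareLattice) H =
      (1 / 2 : ℝ) • (1 + restrictedTransition (srwStep squareLattice) H) := by
  ext y z
  simp only [restrictedTransition, Matrix.of_apply, Matrix.smul_apply, Matrix.add_apply,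
    lsrwStep_toReal, Matrix.one_apply, smul_eq_mul, Subtype.ext_iff, eq_comm (a := (z : ℤ × ℤ)),
    mul_add]

theorem angle_pos {R j : ℕ} (hj : 0 < j) : 0 < angle R j := by
  unfold angle
  have : (0 : ℝ) < j := by exact_mod_cast hj
  have := Real.pi_pos
  positivity

theorem angle_lt_pi {R j : ℕ} (hj : j < 2 * (R + 1)) : angle R j < Real.pi := by
  unfold angle
  have : (j : ℝ) < 2 * (R + 1) := by exact_mod_cast hj
  rw [div_lt_iff₀ (by positivity)]
  exact mul_lt_mul_of_pos_left this Real.pi_pos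

/-- The ground state: both arguments of the sines stay in $(0,\pi)$. It is the positive eigenvector
fed to `summable_pow_apply`, for both walks. -/
theorem mode_one_one_pos (x : ℤ × ℤ) (R : ℕ) {y : ℤ × ℤ} (hy : y ∈ ball squareLattice x R) :
    0 < mode x R 1 1 y := by
  have key : ∀ u : ℤ, 0 < u → u < 2 * (R + 1) → 0 < Real.sin (angle R 1 * u) := by
    intro u h0 h1
    have h0' : (0 : ℝ) < u := by exact_mod_cast h0
    have h1' : (u : ℝ) < 2 * (R + 1) := by exact_mod_cast h1
    apply Real.sin_pos_of_pos_of_lt_pi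
    · exact mul_pos (angle_pos one_pos) h0'
    · rw [angle, div_mul_eq_mul_div, div_lt_iff₀ (by positivity)]
      rw [Nat.cast_one, mul_one]
      exact mul_lt_mul_of_pos_left h1' Real.pi_pos
  obtain ⟨⟨h1, h2⟩, h3, h4⟩ := mem_ball_iff_coord.1 hy
  exact mul_pos (key _ h1 h2) (key _ h3 h4)

theorem abs_cos_angle_lt_one {R j : ℕ} (h0 : 0 < j) (hj : j < 2 * (R + 1)) :
    |Real.cos (angle R j)| < 1 := by
  have h := Real.sin_pos_of_pos_of_lt_pi (angle_pos h0) (angle_lt_pi hj)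
  rw [← sq_lt_one_iff_abs_lt_one]
  nlinarith [Real.sin_sq_add_cos_sq (angle R j)]

theorem restrictedTransition_nonneg (step : ℤ × ℤ → PMF (ℤ × ℤ)) (H : Finset (ℤ × ℤ)) (x y : H) :
    0 ≤ restrictedTransition step H x y := ENNReal.toReal_nonneg

theorem cos_sq_angle_one_lt_one (R : ℕ) :
    Real.cos (angle R 1) * Real.cos (angle R 1) < 1 := by
  have := (sq_lt_one_iff_abs_lt_one _).2 (abs_cos_angle_lt_one (R := R) one_pos (by omega))
  rwa [sq] at this

theorem summable_srwStep (x : ℤ × ℤ) (R : ℕ) (y z : ball squareLattice x R) : Summable fun t : ℕ =>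
    (restrictedTransition (srwStep squareLattice) (ball squareLattice x R) ^ t) y z :=
  summable_pow_apply (restrictedTransition_nonneg _ _)
    (fun y => mode_one_one_pos x R y.2) (mul_self_nonneg _) (cos_sq_angle_one_lt_one R)
    (srwStep_mulVec_mode x R 1 1) y z

theorem summable_lsrwStep (x : ℤ × ℤ) (R : ℕ) (y z : ball squareLattice x R) :
    Summable fun t : ℕ =>
      (restrictedTransition (lsrwStep squareLattice) (ball squareLattice x R) ^ t) y z := by
  refine summable_pow_apply (restrictedTransition_nonneg _ _)
    (fun y => mode_one_one_pos x R y.2)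
    (r := 1 / 2 * (1 + Real.cos (angle R 1) * Real.cos (angle R 1))) ?_ ?_ ?_ y z
  · have := mul_self_nonneg (Real.cos (angle R 1))
    positivity
  · have := cos_sq_angle_one_lt_one R
    linarith
  · rw [restrictedTransition_lsrwStep, Matrix.smul_mulVec, Matrix.add_mulVec, Matrix.one_mulVec,
      srwStep_mulVec_mode]
    module

theorem srwStep_comm (x y : ℤ × ℤ) : srwStep squareLattice x y = srwStep squareLattice y x := by
  simp only [srwStep_apply, mem_neighbours_comm (x := x)]

theorem lsrwStep_comm (x y : ℤ × ℤ) : lsrwStep squareLattice x y = lsrwStep squareLattice y x := by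
  simp only [lsrwStep_apply, srwStep_comm x y, eq_comm (a := x)]

/-- $1-\frac12(1+Q)=\frac12(1-Q)$, so the inverse doubles. -/
theorem zetaOne_lsrwStep (x : ℤ × ℤ) (R : ℕ) :
    zetaOne (lsrwStep squareLattice) (ball squareLattice x R) =
      2 * zetaOne (srwStep squareLattice) (ball squareLattice x R) := by
  rw [zetaOne_eq_trace _ _ (summable_srwStep x R), zetaOne_eq_trace _ _ (summable_lsrwStep x R),
    dirichletLaplacian_eq, dirichletLaplacian_eq, restrictedTransition_lsrwStep]
  set Q := restrictedTransition (srwStep squareLattice) (ball squareLattice x R) with hQ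
  have hu : IsUnit (1 - Q).det := (geometric_inverse (summable_srwStep x R)).1
  have h : (1 - (1 / 2 : ℝ) • (1 + Q))⁻¹ = (2 : ℝ) • (1 - Q)⁻¹ := by
    apply Matrix.inv_eq_right_inv
    rw [show 1 - (1 / 2 : ℝ) • (1 + Q) = (1 / 2 : ℝ) • (1 - Q) by module, smul_mul_smul_comm,
      Matrix.mul_nonsing_inv _ hu]
    norm_num
  rw [h, Matrix.trace_smul, smul_eq_mul]

/-! ### Trigonometric sums -/

/-- Telescoping: $2\cos(jx)\sin(x/2)=\sin(jx+x/2)-\sin(jx-x/2)$. -/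
theorem sum_range_cos_mul (n : ℕ) (x : ℝ) :
    (∑ j ∈ Finset.range n, Real.cos (j * x)) * (2 * Real.sin (x / 2)) =
      Real.sin (n * x - x / 2) + Real.sin (x / 2) := by
  induction n with
  | zero => simp [Real.sin_neg]
  | succ n ih =>
    rw [Finset.sum_range_succ, add_mul, ih]
    push_cast
    rw [show ((n : ℝ) + 1) * x - x / 2 = n * x + x / 2 by ring, Real.sin_add, Real.sin_sub]
    ring

/-- Non-divisibility says that the factor $\sin(x/2)$ of the telescoped sum is nonzero; the upper
end sits at $\pi a-x/2$, so only the parity of `a` survives. -/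
theorem sum_range_cos_angle (R : ℕ) {a : ℤ} (ha : ¬ (4 * (R + 1) : ℤ) ∣ a) :
    ∑ j ∈ Finset.range (2 * (R + 1)), Real.cos (angle R j * a) = (1 - (-1) ^ a) / 2 := by
  have hR : ((R : ℝ) + 1) ≠ 0 := by positivity
  set x : ℝ := Real.pi * a / (2 * (R + 1)) with hx
  have h0 : Real.sin (x / 2) ≠ 0 := by
    intro h
    obtain ⟨n, hn⟩ := Real.sin_eq_zero_iff.1 h
    apply ha
    refine ⟨n, ?_⟩
    have hpi := Real.pi_ne_zero
    rw [hx] at hn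
    field_simp at hn
    have : (a : ℝ) = 4 * (R + 1) * n := by linarith
    exact_mod_cast this
  have h1 := sum_range_cos_mul (2 * (R + 1)) x
  have h2 : ((2 * (R + 1) : ℕ) : ℝ) * x - x / 2 = a * Real.pi - x / 2 := by
    rw [hx]
    push_cast
    field_simp
  rw [h2, Real.sin_int_mul_pi_sub] at h1
  have h3 : ∀ j : ℕ, angle R j * a = j * x := by
    intro j
    rw [hx, angle]
    ring
  simp_rw [h3]
  rw [eq_div_iff two_ne_zero]
  apply mul_right_cancel₀ h0
  linear_combination h1

theorem sum_range_cos_angle_of_dvd (R : ℕ) {a : ℤ} (ha : (4 * (R + 1) : ℤ) ∣ a) :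
    ∑ j ∈ Finset.range (2 * (R + 1)), Real.cos (angle R j * a) = 2 * (R + 1) := by
  obtain ⟨b, rfl⟩ := ha
  have hR : ((R : ℝ) + 1) ≠ 0 := by positivity
  have : ∀ j ∈ Finset.range (2 * (R + 1)),
      Real.cos (angle R j * (4 * (R + 1) * b : ℤ)) = 1 := by
    intro j _
    rw [← Real.cos_int_mul_two_pi (j * b)]
    congr 1
    rw [angle]
    push_cast
    field_simp
    ring
  rw [Finset.sum_congr rfl this]
  simp

/-- Product to sum: $u-v$ and $u+v$ have equal parity, so the two cosine sums cancel unless $u=v$.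
-/
theorem sum_range_sin_mul_sin (R : ℕ) {u v : ℤ} (hu : 0 < u) (hu' : u < 2 * (R + 1)) (hv : 0 < v)
    (hv' : v < 2 * (R + 1)) :
    ∑ j ∈ Finset.range (2 * (R + 1)), Real.sin (angle R j * u) * Real.sin (angle R j * v) =
      if u = v then (R + 1 : ℝ) else 0 := by
  have h : ∀ j : ℕ, Real.sin (angle R j * u) * Real.sin (angle R j * v) =
      Real.cos (angle R j * (u - v : ℤ)) / 2 - Real.cos (angle R j * (u + v : ℤ)) / 2 := by
    intro j
    push_cast
    rw [mul_sub, mul_add, Real.cos_sub, Real.cos_add]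
    ring
  have hadd : ¬ (4 * (R + 1) : ℤ) ∣ u + v := fun h => by
    have := Int.le_of_dvd (by omega) h
    omega
  simp_rw [h]
  rw [Finset.sum_sub_distrib, ← Finset.sum_div, ← Finset.sum_div, sum_range_cos_angle R hadd]
  split_ifs with huv
  · subst huv
    rw [sum_range_cos_angle_of_dvd R (by simp), Even.neg_one_zpow ⟨u, rfl⟩]
    ring
  · have hsub : ¬ (4 * (R + 1) : ℤ) ∣ u - v := fun h => by
      have := Int.eq_zero_of_abs_lt_dvd h (by rw [abs_lt]; omega)
      omega
    rw [sum_range_cos_angle R hsub, show u + v = u - v + 2 * v by ring,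
      zpow_add₀ (by norm_num), Even.neg_one_zpow (even_two_mul v)]
    ring

theorem angle_mul_comm (R j u : ℕ) : angle R j * u = angle R u * j := by
  unfold angle
  ring

theorem sum_range_sin_sq (R : ℕ) {j : ℕ} (h0 : 0 < j) (hj : j < 2 * (R + 1)) :
    ∑ u ∈ Finset.range (2 * (R + 1)), Real.sin (angle R j * u) ^ 2 = R + 1 := by
  have h := sum_range_sin_mul_sin R (u := j) (v := j) (by omega) (by omega) (by omega) (by omega)
  rw [if_pos rfl] at h
  rw [← h]
  refine Finset.sum_congr rfl fun u _ => ?_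
  rw [angle_mul_comm, sq]
  rfl

/-- The sign $(-1)^u=\cos(\pi u)$ shifts the frequency $2\theta_j$ by $\pm\pi$, and resonance occurs
only at $\theta_j=\pi/2$. These sums are the parity corrections in `sum_ball`. -/
theorem sum_range_neg_one_pow_mul_sin_sq (R : ℕ) {j : ℕ} (h0 : 0 < j) (hj : j < 2 * (R + 1)) :
    ∑ u ∈ Finset.range (2 * (R + 1)), (-1) ^ u * Real.sin (angle R j * u) ^ 2 =
      if j = R + 1 then - (R + 1 : ℝ) else 0 := by
  have hR : ((R : ℝ) + 1) ≠ 0 := by positivity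
  have h : ∀ u : ℕ, (-1) ^ u * Real.sin (angle R j * u) ^ 2 =
      Real.cos (angle R u * (2 * (R + 1) : ℤ)) / 2 -
        (Real.cos (angle R u * (2 * (j + (R + 1)) : ℤ)) / 4 +
          Real.cos (angle R u * (2 * (j - (R + 1)) : ℤ)) / 4) := by
    intro u
    have e1 : angle R u * (2 * (R + 1)) = u * Real.pi := by
      rw [angle]
      field_simp
    push_cast
    rw [show angle R u * (2 * ((j : ℝ) + (R + 1))) = 2 * (angle R u * j) + u * Real.pi by
      rw [← e1]; ring, show angle R u * (2 * ((j : ℝ) - (R + 1))) = 2 * (angle R u * j) - u * Real.pi by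
      rw [← e1]; ring, e1, Real.cos_add_nat_mul_pi, Real.cos_sub_nat_mul_pi, Real.cos_nat_mul_pi,
      angle_mul_comm, Real.sin_sq_eq_half_sub]
    ring
  simp_rw [h]
  rw [Finset.sum_sub_distrib, Finset.sum_add_distrib, ← Finset.sum_div, ← Finset.sum_div,
    ← Finset.sum_div]
  rw [sum_range_cos_angle R (a := 2 * (R + 1)) (fun h => by
    have := Int.le_of_dvd (by omega) h
    omega), Even.neg_one_zpow (even_two_mul _)]
  split_ifs with hjR
  · subst hjR
    rw [sum_range_cos_angle_of_dvd R ⟨1, by push_cast; ring⟩,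
      sum_range_cos_angle_of_dvd R ⟨0, by push_cast; ring⟩]
    ring
  · rw [sum_range_cos_angle R (a := 2 * (j + (R + 1))), sum_range_cos_angle R (a := 2 * (j - (R + 1))),
      Even.neg_one_zpow (even_two_mul _), Even.neg_one_zpow (even_two_mul _)]
    · ring
    · intro h
      have := Int.eq_zero_of_abs_lt_dvd h (by rw [abs_lt]; omega)
      omega
    · intro h
      have h' : (4 * (R + 1) : ℤ) ∣ 2 * (j + (R + 1)) - 4 * (R + 1) := h.sub dvd_rfl
      have := Int.eq_zero_of_abs_lt_dvd h' (by rw [abs_lt]; omega)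
      omega

/-- Sums over a ball in rotated coordinates. -/
theorem sum_ball (x : ℤ × ℤ) (R : ℕ) (f g : ℤ → ℝ) (hf : f 0 = 0) (hg : g 0 = 0) :
    ∑ y ∈ ball squareLattice x R, f (coordSum x R y) * g (coordDiff x R y) =
      ((∑ u ∈ Finset.range (2 * (R + 1)), f u) * (∑ v ∈ Finset.range (2 * (R + 1)), g v) +
        (∑ u ∈ Finset.range (2 * (R + 1)), (-1) ^ u * f u) *
          (∑ v ∈ Finset.range (2 * (R + 1)), (-1) ^ v * g v)) / 2 := by
  -- The weight $(1+(-1)^{u+v})/2$ selects the pairs of equal parity, which are those coming from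
  -- lattice points; `hf` and `hg` remove the sides $u=0$ and $v=0$.
  have h1 : ((∑ u ∈ Finset.range (2 * (R + 1)), f u) * (∑ v ∈ Finset.range (2 * (R + 1)), g v) +
        (∑ u ∈ Finset.range (2 * (R + 1)), (-1) ^ u * f u) *
          (∑ v ∈ Finset.range (2 * (R + 1)), (-1) ^ v * g v)) / 2 =
      ∑ p ∈ Finset.range (2 * (R + 1)) ×ˢ Finset.range (2 * (R + 1)),
        if (0 < p.1 ∧ 0 < p.2) ∧ Even (p.1 + p.2) then f p.1 * g p.2 else 0 := by
    rw [Finset.sum_mul_sum, Finset.sum_mul_sum, ← Finset.sum_product', ← Finset.sum_product',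
      ← Finset.sum_add_distrib, Finset.sum_div]
    refine Finset.sum_congr rfl fun p _ => ?_
    have e : f p.1 * g p.2 + (-1) ^ p.1 * f p.1 * ((-1) ^ p.2 * g p.2) =
        (1 + (-1) ^ (p.1 + p.2)) * (f p.1 * g p.2) := by
      rw [pow_add]
      ring
    rw [e]
    split_ifs with h
    · rw [Even.neg_one_pow h.2]
      ring
    · rcases Nat.even_or_odd (p.1 + p.2) with hp | hp
      · rcases Nat.eq_zero_or_pos p.1 with h0 | h0
        · simp [h0, hf]
        · rcases Nat.eq_zero_or_pos p.2 with h0' | h0'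
          · simp [h0', hg]
          · exact absurd ⟨⟨h0, h0'⟩, hp⟩ h
      · rw [Odd.neg_one_pow hp]
        simp
  rw [h1, ← Finset.sum_filter]
  -- The inverse rotation; both divisions by `2` are exact because the parities agree.
  refine Finset.sum_bij' (fun y _ => ((coordSum x R y).toNat, (coordDiff x R y).toNat))
    (fun p _ => (x.1 + (((p.1 + p.2 : ℕ) : ℤ) / 2 - (R + 1)), x.2 + ((p.1 : ℤ) - p.2) / 2))
    ?_ ?_ ?_ ?_ ?_
  · intro y hy
    rw [mem_ball_iff_coord] at hy
    simp only [Finset.mem_filter, Finset.mem_product, Finset.mem_range, Nat.even_iff]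
    unfold coordSum coordDiff at *
    omega
  · rintro ⟨a, b⟩ hp
    simp only [Finset.mem_filter, Finset.mem_product, Finset.mem_range, Nat.even_iff] at hp
    rw [mem_ball_iff_coord]
    unfold coordSum coordDiff
    dsimp only
    omega
  · intro y hy
    rw [mem_ball_iff_coord] at hy
    unfold coordSum coordDiff at *
    dsimp only
    ext <;> dsimp only <;> omega
  · rintro ⟨a, b⟩ hp
    simp only [Finset.mem_filter, Finset.mem_product, Finset.mem_range, Nat.even_iff] at hp
    unfold coordSum coordDiff
    ext <;> dsimp only <;> omega
  · intro y hy
    rw [mem_ball_iff_coord] at hy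
    dsimp only
    rw [Int.toNat_of_nonneg hy.1.1.le, Int.toNat_of_nonneg hy.2.1.le]

/-- Taking for `f` and `g` the indicator of nonzero integers, the alternating sums are $-1$ and the
count is $((2R+1)^2+1)/2$. -/
theorem card_ball (x : ℤ × ℤ) (R : ℕ) :
    ((ball squareLattice x R).card : ℝ) = 2 * (R : ℝ) ^ 2 + 2 * R + 1 := by
  have h := sum_ball x R (fun u => if u = 0 then 0 else 1) (fun u => if u = 0 then 0 else 1)
    (by simp) (by simp)
  have e1 : ∑ y ∈ ball squareLattice x R, ((if coordSum x R y = 0 then (0 : ℝ) else 1) *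
      if coordDiff x R y = 0 then 0 else 1) = (ball squareLattice x R).card := by
    rw [Finset.card_eq_sum_ones, Nat.cast_sum]
    refine Finset.sum_congr rfl fun y hy => ?_
    rw [mem_ball_iff_coord] at hy
    rw [if_neg hy.1.1.ne', if_neg hy.2.1.ne']
    simp
  have e2 : ∑ u ∈ Finset.range (2 * (R + 1)), (if (u : ℤ) = 0 then (0 : ℝ) else 1) = 2 * R + 1 := by
    rw [show 2 * (R + 1) = (2 * R + 1) + 1 by ring, Finset.sum_range_succ']
    simp [Nat.cast_add_one_ne_zero, -Nat.cast_add]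
    push_cast
    ring
  have e3 : ∀ n : ℕ, ∑ u ∈ Finset.range (2 * (n + 1)),
      (-1) ^ u * (if (u : ℤ) = 0 then (0 : ℝ) else 1) = -1 := by
    intro n
    induction n with
    | zero => simp [Finset.sum_range_succ]
    | succ n ih =>
      rw [show 2 * (n + 1 + 1) = 2 * (n + 1) + 1 + 1 by ring, Finset.sum_range_succ,
        Finset.sum_range_succ, ih, pow_succ, if_neg (by omega), if_neg (by omega)]
      ring
  rw [e1, e2, e3] at h
  rw [h]
  ring

/-! ### The trace of the Green function -/

theorem mode_zero_left (x : ℤ × ℤ) (R k : ℕ) (y : ℤ × ℤ) : mode x R 0 k y = 0 := by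
  simp [mode, angle]

theorem mode_zero_right (x : ℤ × ℤ) (R j : ℕ) (y : ℤ × ℤ) : mode x R j 0 y = 0 := by
  simp [mode, angle]

theorem cos_angle_mul_lt_one {R j k : ℕ} (hj0 : 0 < j) (hj : j < 2 * (R + 1)) (hk0 : 0 < k)
    (hk : k < 2 * (R + 1)) : Real.cos (angle R j) * Real.cos (angle R k) < 1 := by
  have h1 := abs_cos_angle_lt_one hj0 hj
  have h2 := abs_cos_angle_lt_one hk0 hk
  calc _ ≤ |Real.cos (angle R j) * Real.cos (angle R k)| := le_abs_self _
    _ < 1 := by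
      rw [abs_mul]
      exact mul_lt_one_of_nonneg_of_lt_one_left (abs_nonneg _) h1 h2.le

/-- Completeness of the modes: the double sum factors into two one-dimensional orthogonality
relations, and the rotated coordinates separate points. -/
theorem sum_mode_mul_mode (x : ℤ × ℤ) (R : ℕ) {y z : ℤ × ℤ} (hy : y ∈ ball squareLattice x R)
    (hz : z ∈ ball squareLattice x R) :
    ∑ j ∈ Finset.range (2 * (R + 1)), ∑ k ∈ Finset.range (2 * (R + 1)),
      mode x R j k y * mode x R j k z = if y = z then (R + 1 : ℝ) ^ 2 else 0 := by
  rw [mem_ball_iff_coord] at hy hz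
  have h : ∀ j k : ℕ, mode x R j k y * mode x R j k z =
      (Real.sin (angle R j * coordSum x R y) * Real.sin (angle R j * coordSum x R z)) *
        (Real.sin (angle R k * coordDiff x R y) * Real.sin (angle R k * coordDiff x R z)) := by
    intro j k
    unfold mode
    ring
  simp_rw [h]
  rw [← Finset.sum_mul_sum, sum_range_sin_mul_sin R hy.1.1 hy.1.2 hz.1.1 hz.1.2,
    sum_range_sin_mul_sin R hy.2.1 hy.2.2 hz.2.1 hz.2.2]
  by_cases h3 : y = z
  · subst h3
    rw [if_pos rfl, if_pos rfl, if_pos rfl, sq]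
  · rw [if_neg h3]
    by_cases h1 : coordSum x R y = coordSum x R z
    · rw [if_neg (c := coordDiff x R y = coordDiff x R z), mul_zero]
      intro h2
      refine absurd (Prod.ext ?_ ?_) h3 <;> unfold coordSum at h1 <;> unfold coordDiff at h2 <;>
        omega
    · rw [if_neg h1, zero_mul]

/-- Applying $1-Q$ to a mode cancels its denominator, and completeness gives the identity. -/
theorem srwStep_laplacian_inv (x : ℤ × ℤ) (R : ℕ) :
    (dirichletLaplacian (srwStep squareLattice) (ball squareLattice x R))⁻¹ =
      Matrix.of fun y z : ball squareLattice x R => (1 / (R + 1 : ℝ) ^ 2) *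
        ∑ j ∈ Finset.range (2 * (R + 1)), ∑ k ∈ Finset.range (2 * (R + 1)),
          mode x R j k y * mode x R j k z /
            (1 - Real.cos (angle R j) * Real.cos (angle R k)) := by
  apply Matrix.inv_eq_right_inv
  rw [dirichletLaplacian_eq]
  set Q := restrictedTransition (srwStep squareLattice) (ball squareLattice x R) with hQ
  ext y z
  have hmode : ∀ j k : ℕ, ∑ w, (1 - Q) y w * mode x R j k w =
      (1 - Real.cos (angle R j) * Real.cos (angle R k)) * mode x R j k y := by
    intro j k
    have h := congrFun (srwStep_mulVec_mode x R j k) y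
    have h' : (1 - Q).mulVec (fun w => mode x R j k w) y =
        (1 - Real.cos (angle R j) * Real.cos (angle R k)) * mode x R j k y := by
      rw [Matrix.sub_mulVec, Matrix.one_mulVec, Pi.sub_apply, h, Pi.smul_apply, smul_eq_mul]
      ring
    exact h'
  have hR : ((R : ℝ) + 1) ≠ 0 := by positivity
  calc ((1 - Q) * Matrix.of fun y z : ball squareLattice x R => (1 / (R + 1 : ℝ) ^ 2) *
        ∑ j ∈ Finset.range (2 * (R + 1)), ∑ k ∈ Finset.range (2 * (R + 1)),
          mode x R j k y * mode x R j k z /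
            (1 - Real.cos (angle R j) * Real.cos (angle R k)) : Matrix _ _ ℝ) y z
      = ∑ j ∈ Finset.range (2 * (R + 1)), ∑ k ∈ Finset.range (2 * (R + 1)),
          (1 / (R + 1 : ℝ) ^ 2) * ((∑ w, (1 - Q) y w * mode x R j k w) *
          (mode x R j k z / (1 - Real.cos (angle R j) * Real.cos (angle R k)))) := by
        rw [Matrix.mul_apply]
        simp only [Matrix.of_apply, Finset.mul_sum, Finset.sum_mul]
        rw [Finset.sum_comm]
        refine Finset.sum_congr rfl fun j _ => ?_
        rw [Finset.sum_comm]
        refine Finset.sum_congr rfl fun k _ => Finset.sum_congr rfl fun w _ => ?_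
        ring
    _ = ∑ j ∈ Finset.range (2 * (R + 1)), ∑ k ∈ Finset.range (2 * (R + 1)),
          (1 / (R + 1 : ℝ) ^ 2) * (mode x R j k y * mode x R j k z) := by
        refine Finset.sum_congr rfl fun j hj => Finset.sum_congr rfl fun k hk => ?_
        rw [hmode]
        -- Modes with a zero index vanish; this covers $j=k=0$, where the denominator is zero.
        rcases Nat.eq_zero_or_pos j with rfl | hj0
        · simp [mode_zero_left]
        rcases Nat.eq_zero_or_pos k with rfl | hk0
        · simp [mode_zero_right]
        have := cos_angle_mul_lt_one hj0 (Finset.mem_range.1 hj) hk0 (Finset.mem_range.1 hk)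
        have hne : 1 - Real.cos (angle R j) * Real.cos (angle R k) ≠ 0 := by linarith
        field_simp
    _ = (1 : Matrix _ _ ℝ) y z := by
        simp_rw [← Finset.mul_sum]
        rw [sum_mode_mul_mode x R y.2 z.2, Matrix.one_apply]
        simp only [Subtype.ext_iff]
        split_ifs
        · field_simp
        · simp

/-- The parity correction is a product of two resonances, so only the central mode, fixed by the
reflection $(j,k)\mapsto(M-j,M-k)$, has twice the norm squared. With eigenvalue $0$ it yields the `+
1` in `zetaOne_srwStep`. -/
theorem sum_ball_mode_sq (x : ℤ × ℤ) (R : ℕ) {j k : ℕ} (hj0 : 0 < j) (hj : j < 2 * (R + 1))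
    (hk0 : 0 < k) (hk : k < 2 * (R + 1)) :
    ∑ y ∈ ball squareLattice x R, mode x R j k y * mode x R j k y =
      (R + 1 : ℝ) ^ 2 * (1 + if j = R + 1 ∧ k = R + 1 then 1 else 0) / 2 := by
  have h := sum_ball x R (fun u => Real.sin (angle R j * u) ^ 2)
    (fun v => Real.sin (angle R k * v) ^ 2) (by simp) (by simp)
  simp only [Int.cast_natCast] at h
  rw [sum_range_sin_sq R hj0 hj, sum_range_sin_sq R hk0 hk,
    sum_range_neg_one_pow_mul_sin_sq R hj0 hj, sum_range_neg_one_pow_mul_sin_sq R hk0 hk] at h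
  calc _ = _ := Finset.sum_congr rfl fun y _ => by unfold mode; ring
    _ = _ := h
    _ = _ := by split_ifs <;> simp_all <;> ring

theorem zetaOne_srwStep (x : ℤ × ℤ) (R : ℕ) :
    zetaOne (srwStep squareLattice) (ball squareLattice x R) =
      (∑ j ∈ Finset.Ioo 0 (2 * (R + 1)), ∑ k ∈ Finset.Ioo 0 (2 * (R + 1)),
        1 / (1 - Real.cos (angle R j) * Real.cos (angle R k)) + 1) / 2 := by
  have hR : ((R : ℝ) + 1) ≠ 0 := by positivity
  have hsub : Finset.Ioo 0 (2 * (R + 1)) ⊆ Finset.range (2 * (R + 1)) := fun i hi =>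
    Finset.mem_range.2 (Finset.mem_Ioo.1 hi).2
  rw [zetaOne_eq_trace _ _ (summable_srwStep x R), srwStep_laplacian_inv, Matrix.trace]
  simp only [Matrix.diag_apply, Matrix.of_apply]
  rw [Finset.sum_coe_sort (ball squareLattice x R) (fun y => (1 / (R + 1 : ℝ) ^ 2) *
        ∑ j ∈ Finset.range (2 * (R + 1)), ∑ k ∈ Finset.range (2 * (R + 1)),
          mode x R j k y * mode x R j k y /
            (1 - Real.cos (angle R j) * Real.cos (angle R k))), ← Finset.mul_sum, Finset.sum_comm,
    ← Finset.sum_subset hsub]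
  · have h : ∀ j ∈ Finset.Ioo 0 (2 * (R + 1)), ∑ y ∈ ball squareLattice x R,
        ∑ k ∈ Finset.range (2 * (R + 1)), mode x R j k y * mode x R j k y /
            (1 - Real.cos (angle R j) * Real.cos (angle R k)) =
        ∑ k ∈ Finset.Ioo 0 (2 * (R + 1)), ((R + 1 : ℝ) ^ 2 / 2 *
          (1 / (1 - Real.cos (angle R j) * Real.cos (angle R k))) +
          (R + 1 : ℝ) ^ 2 / 2 * (if k = R + 1 then (if j = R + 1 then 1 else 0) else 0)) := by
      intro j hj
      rw [Finset.mem_Ioo] at hj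
      rw [Finset.sum_comm, ← Finset.sum_subset hsub]
      · refine Finset.sum_congr rfl fun k hk => ?_
        rw [Finset.mem_Ioo] at hk
        rw [← Finset.sum_div, sum_ball_mode_sq x R hj.1 hj.2 hk.1 hk.2]
        by_cases h1 : j = R + 1
        · by_cases h2 : k = R + 1
          · have e : Real.cos (angle R k) = 0 := by
              rw [h2, angle, ← Real.cos_pi_div_two]
              congr 1
              push_cast
              field_simp
            rw [e]
            simp [h1, h2]
            ring
          · simp [h2]
            ring
        · simp [h1]
          ring
      · intro k hk hk'
        have : k = 0 := by
          rw [Finset.mem_range] at hk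
          rw [Finset.mem_Ioo] at hk'
          omega
        subst this
        simp [mode_zero_right]
    rw [Finset.sum_congr rfl h]
    have hm : R + 1 ∈ Finset.Ioo 0 (2 * (R + 1)) := Finset.mem_Ioo.2 ⟨by omega, by omega⟩
    simp_rw [Finset.sum_add_distrib, ← Finset.mul_sum, Finset.sum_ite_eq', if_pos hm,
      Finset.sum_ite_eq', if_pos hm]
    field_simp
  · intro j hj hj'
    have : j = 0 := by
      rw [Finset.mem_range] at hj
      rw [Finset.mem_Ioo] at hj'
      omega
    subst this
    simp [mode_zero_left]

/-! ### Asymptotics of the trace -/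

/-- A primitive smooth on the whole line, since $1+s-c\cos x>0$, unlike the one from $\tan(x/2)$.
The arctangent vanishes at $0$ and $\pi$, so the integral over $[0,\pi]$ is $\pi/s$. -/
theorem hasDerivAt_poisson_primitive {c s : ℝ} (hs : 0 < s) (hcs : c ^ 2 + s ^ 2 = 1) (x : ℝ) :
    HasDerivAt (fun x => (x + 2 * Real.arctan (c * Real.sin x / (1 + s - c * Real.cos x))) / s)
      (1 / (1 - c * Real.cos x)) x := by
  have hc : |c| < 1 := by
    rw [← sq_lt_one_iff_abs_lt_one]
    nlinarith
  have hcc : c * Real.cos x < 1 := by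
    calc c * Real.cos x ≤ |c * Real.cos x| := le_abs_self _
      _ < 1 := by
        rw [abs_mul]
        exact mul_lt_one_of_nonneg_of_lt_one_left (abs_nonneg _) hc (Real.abs_cos_le_one x)
  have hD : 1 + s - c * Real.cos x ≠ 0 := by linarith
  have hE : 1 - c * Real.cos x ≠ 0 := by linarith
  have h1 : HasDerivAt (fun x => c * Real.sin x / (1 + s - c * Real.cos x))
      ((c * Real.cos x * (1 + s - c * Real.cos x) - c * Real.sin x * (c * Real.sin x)) /
        (1 + s - c * Real.cos x) ^ 2) x := by
    refine ((Real.hasDerivAt_sin x).const_mul c).div ?_ hD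
    exact (((Real.hasDerivAt_cos x).const_mul c).const_sub (1 + s)).congr_deriv (by ring)
  refine HasDerivAt.congr_deriv (((hasDerivAt_id x).add (h1.arctan.const_mul 2)).div_const s) ?_
  have hsc := Real.sin_sq_add_cos_sq x
  have hden : (1 + s - c * Real.cos x) ^ 2 + (c * Real.sin x) ^ 2 =
      2 * (1 + s) * (1 - c * Real.cos x) := by
    linear_combination c ^ 2 * hsc + hcs
  have hnum : c * Real.cos x * (1 + s - c * Real.cos x) - c * Real.sin x * (c * Real.sin x) =
      (1 + s) * (c * Real.cos x - 1 + s) := by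
    linear_combination (- c ^ 2) * hsc - hcs
  have h1s : 1 + s ≠ 0 := by linarith
  have e : 1 / (1 + (c * Real.sin x / (1 + s - c * Real.cos x)) ^ 2) *
      ((c * Real.cos x * (1 + s - c * Real.cos x) - c * Real.sin x * (c * Real.sin x)) /
        (1 + s - c * Real.cos x) ^ 2) = (c * Real.cos x - 1 + s) / (2 * (1 - c * Real.cos x)) := by
    rw [hnum, div_pow, one_add_div (pow_ne_zero 2 hD), hden]
    field_simp
  rw [e]
  field_simp
  ring

theorem angle_nonneg (R j : ℕ) : 0 ≤ angle R j := by
  unfold angle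
  have := Real.pi_pos
  positivity

theorem sum_range_succ_eq_sum_Ioo (m : ℕ) (f : ℕ → ℝ) :
    ∑ i ∈ Finset.range m, f (i + 1) = ∑ k ∈ Finset.Ioo 0 (m + 1), f k := by
  refine Finset.sum_bij' (fun i _ => i + 1) (fun k _ => k - 1) ?_ ?_ ?_ ?_ ?_ <;>
    intro i hi <;> simp only [Finset.mem_range, Finset.mem_Ioo] at * <;> omega

theorem sum_Ioo_reflect (m : ℕ) (f : ℕ → ℝ) :
    ∑ k ∈ Finset.Ioo 0 m, f (m - k) = ∑ k ∈ Finset.Ioo 0 m, f k := by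
  refine Finset.sum_bij' (fun k _ => m - k) (fun k _ => m - k) ?_ ?_ ?_ ?_ ?_ <;>
    intro i hi <;> simp only [Finset.mem_Ioo] at * <;> omega

theorem angle_reflect {R k : ℕ} (hk : k ≤ 2 * (R + 1)) :
    angle R (2 * (R + 1) - k) = Real.pi - angle R k := by
  have hR : ((R : ℝ) + 1) ≠ 0 := by positivity
  unfold angle
  push_cast [hk]
  field_simp

/-- For $c\ge0$ the integrand decreases on $[0,\pi]$, so left and right Riemann sums enclose the
integral; the left one has the extra term $1/(1-c)$ at $0$. -/
theorem sum_poisson_bounds_of_nonneg (R : ℕ) {c s : ℝ} (hs : 0 < s) (hcs : c ^ 2 + s ^ 2 = 1)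
    (hc0 : 0 ≤ c) :
    2 * (R + 1) / s - 1 / (1 - c) ≤
        ∑ k ∈ Finset.Ioo 0 (2 * (R + 1)), 1 / (1 - c * Real.cos (angle R k)) ∧
      ∑ k ∈ Finset.Ioo 0 (2 * (R + 1)), 1 / (1 - c * Real.cos (angle R k)) ≤
        2 * (R + 1) / s := by
  have hR : ((R : ℝ) + 1) ≠ 0 := by positivity
  have hpi := Real.pi_pos
  have hc1 : c < 1 := by nlinarith
  have hpos : ∀ x : ℝ, 0 < 1 - c * Real.cos x := by
    intro x
    have := mul_le_mul_of_nonneg_left (Real.cos_le_one x) hc0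
    linarith
  set q : ℝ := Real.pi / (2 * (R + 1)) with hq
  have hq0 : 0 < q := by positivity
  set g : ℝ → ℝ := fun t => 1 / (1 - c * Real.cos (q * t)) with hg
  have hgk : ∀ k : ℕ, g k = 1 / (1 - c * Real.cos (angle R k)) := by
    intro k
    rw [hg, angle]
    dsimp only
    rw [hq, div_mul_eq_mul_div]
  have hint : ∫ t in (0 : ℝ)..(0 + (2 * (R + 1) : ℕ)), g t = 2 * (R + 1) / s := by
    have hderiv : ∀ t : ℝ, HasDerivAt (fun t => ((q * t + 2 * Real.arctan
        (c * Real.sin (q * t) / (1 + s - c * Real.cos (q * t)))) / s) / q) (g t) t := by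
      intro t
      have h1 := (hasDerivAt_poisson_primitive hs hcs (q * t)).comp t
        ((hasDerivAt_id t).const_mul q)
      refine HasDerivAt.congr_deriv (h1.div_const q) ?_
      rw [hg]
      field_simp
    rw [intervalIntegral.integral_eq_sub_of_hasDerivAt (fun t _ => hderiv t)]
    · have e : q * (0 + (2 * (R + 1) : ℕ)) = Real.pi := by
        rw [hq]
        push_cast
        field_simp
        ring
      rw [e]
      simp
      rw [hq]
      field_simp
    · apply Continuous.intervalIntegrable
      rw [hg]
      exact continuous_const.div (by fun_prop) fun t => (hpos _).ne'
  have hanti : AntitoneOn g (Set.Icc (0 : ℝ) (0 + (2 * (R + 1) : ℕ))) := by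
    intro a ha b hb hab
    have hbpi : q * b ≤ Real.pi := by
      have := hb.2
      push_cast at this
      rw [hq, div_mul_eq_mul_div, div_le_iff₀ (by positivity)]
      exact mul_le_mul_of_nonneg_left (by linarith) hpi.le
    have h1 : Real.cos (q * b) ≤ Real.cos (q * a) :=
      Real.cos_le_cos_of_nonneg_of_le_pi (mul_nonneg hq0.le ha.1) hbpi
        (mul_le_mul_of_nonneg_left hab hq0.le)
    apply one_div_le_one_div_of_le (hpos _)
    have := mul_le_mul_of_nonneg_left h1 hc0
    linarith
  have hup := hanti.sum_le_integral
  have hlo := hanti.integral_le_sum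
  rw [hint] at hup hlo
  simp only [zero_add, hgk] at hup hlo
  rw [show 2 * (R + 1) = (2 * R + 1) + 1 by ring] at hup hlo ⊢
  rw [Finset.sum_range_succ'] at hlo
  rw [Finset.sum_range_succ] at hup
  rw [sum_range_succ_eq_sum_Ioo (2 * R + 1) (fun k => 1 / (1 - c * Real.cos (angle R k)))] at hup hlo
  have h0 : angle R 0 = 0 := by simp [angle]
  rw [h0, Real.cos_zero, mul_one] at hlo
  have := one_div_pos.2 (hpos (angle R (2 * R + 1 + 1)))
  constructor <;> linarith

/-- Reflecting $k\mapsto M-k$ changes the sign of the cosine and reduces to $c\ge0$; then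
$1/(1-c)=(1+c)/s^2\le2/s^2$. -/
theorem abs_sum_poisson_sub_le (R : ℕ) {c s : ℝ} (hs : 0 < s) (hcs : c ^ 2 + s ^ 2 = 1) :
    |∑ k ∈ Finset.Ioo 0 (2 * (R + 1)), 1 / (1 - c * Real.cos (angle R k)) - 2 * (R + 1) / s| ≤
      2 * (1 / s ^ 2) := by
  wlog hc : 0 ≤ c generalizing c
  · have h := this (c := -c) (by rw [neg_sq]; exact hcs) (by linarith)
    rw [← sum_Ioo_reflect] at h
    convert h using 5 with k hk
    rw [Finset.mem_Ioo] at hk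
    rw [angle_reflect hk.2.le, Real.cos_pi_sub]
    ring
  obtain ⟨h1, h2⟩ := sum_poisson_bounds_of_nonneg R hs hcs hc
  have hc1 : c < 1 := by nlinarith
  have h3 : 1 / (1 - c) ≤ 2 * (1 / s ^ 2) := by
    rw [mul_one_div, div_le_div_iff₀ (by linarith) (by positivity)]
    nlinarith
  have h4 : 0 ≤ 2 * (1 / s ^ 2) := by positivity
  rw [abs_le]
  constructor <;> linarith

theorem sum_Ioo_two_mul_of_symm (R : ℕ) (f : ℕ → ℝ)
    (hf : ∀ k, 0 < k → k < R + 1 → f (2 * (R + 1) - k) = f k) :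
    ∑ k ∈ Finset.Ioo 0 (2 * (R + 1)), f k = 2 * ∑ k ∈ Finset.Ioo 0 (R + 1), f k + f (R + 1) := by
  have h1 : Finset.Ioo 0 (2 * (R + 1)) =
      (Finset.Ioo 0 (R + 1) ∪ {R + 1}) ∪ Finset.Ioo (R + 1) (2 * (R + 1)) := by
    ext k
    simp only [Finset.mem_Ioo, Finset.mem_union, Finset.mem_singleton]
    omega
  have h2 : ∑ k ∈ Finset.Ioo (R + 1) (2 * (R + 1)), f k = ∑ k ∈ Finset.Ioo 0 (R + 1), f k := by
    refine Finset.sum_bij' (fun k _ => 2 * (R + 1) - k) (fun k _ => 2 * (R + 1) - k)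
      ?_ ?_ ?_ ?_ ?_
    · intro k hk
      simp only [Finset.mem_Ioo] at *
      omega
    · intro k hk
      simp only [Finset.mem_Ioo] at *
      omega
    · intro k hk
      simp only [Finset.mem_Ioo] at *
      omega
    · intro k hk
      simp only [Finset.mem_Ioo] at *
      omega
    · intro k hk
      simp only [Finset.mem_Ioo] at hk
      rw [← hf (2 * (R + 1) - k) (by omega) (by omega)]
      congr 1
      omega
  rw [h1, Finset.sum_union, Finset.sum_union, Finset.sum_singleton, h2]
  · ring
  · simp
  · rw [Finset.disjoint_left]
    intro k
    simp only [Finset.mem_Ioo, Finset.mem_union, Finset.mem_singleton]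
    omega

theorem angle_middle (R : ℕ) : angle R (R + 1) = Real.pi / 2 := by
  have hR : ((R : ℝ) + 1) ≠ 0 := by positivity
  unfold angle
  push_cast
  field_simp

theorem angle_lt_pi_div_two {R j : ℕ} (hj : j < R + 1) : angle R j < Real.pi / 2 := by
  have hj' : (j : ℝ) < R + 1 := by exact_mod_cast hj
  unfold angle
  rw [div_lt_div_iff₀ (by positivity) (by positivity)]
  nlinarith [Real.pi_pos]

theorem sin_angle_reflect {R k : ℕ} (hk : k ≤ 2 * (R + 1)) :
    Real.sin (angle R (2 * (R + 1) - k)) = Real.sin (angle R k) := by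
  rw [angle_reflect hk, Real.sin_pi_sub]

/-- Jordan's inequality gives $\sin\theta_j\ge j/(R+1)$ on the first half, and $\sum j^{-2}\le2$.
The Riemann-sum errors thus total $O(R^2)$, without a logarithm. -/
theorem sum_inv_sin_sq_le (R : ℕ) :
    ∑ j ∈ Finset.Ioo 0 (2 * (R + 1)), 1 / Real.sin (angle R j) ^ 2 ≤ 4 * (R + 1 : ℝ) ^ 2 + 1 := by
  have hpi := Real.pi_pos
  rw [sum_Ioo_two_mul_of_symm R _ fun k _ hk => by rw [sin_angle_reflect (by omega)], angle_middle,
    Real.sin_pi_div_two]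
  have h : ∀ j ∈ Finset.Ioo 0 (R + 1), 1 / Real.sin (angle R j) ^ 2 ≤
      (R + 1 : ℝ) ^ 2 * ((j : ℝ) ^ 2)⁻¹ := by
    intro j hj
    rw [Finset.mem_Ioo] at hj
    have hj0 : (0 : ℝ) < j := by exact_mod_cast hj.1
    have h1 := Real.mul_le_sin (angle_nonneg R j) (angle_lt_pi_div_two hj.2).le
    have h2 : 2 / Real.pi * angle R j = j / (R + 1) := by
      unfold angle
      field_simp
    rw [h2] at h1
    calc 1 / Real.sin (angle R j) ^ 2 ≤ 1 / (j / (R + 1) : ℝ) ^ 2 := by gcongr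
      _ = _ := by field_simp
  have h1 := Finset.sum_le_sum h
  rw [← Finset.mul_sum] at h1
  have h2 := sum_Ioo_inv_sq_le (α := ℝ) 0 (R + 1)
  have h3 := mul_le_mul_of_nonneg_left h2 (sq_nonneg (R + 1 : ℝ))
  norm_num at h3 ⊢
  norm_num at h1
  linarith

/-- The upper bound reads $x(1-\sin x)\le\sin x$, from $1-\sin x\le\cos x$ and $x\cos x<\sin x$. -/
theorem inv_sin_bounds {x : ℝ} (h0 : 0 < x) (h1 : x < Real.pi / 2) :
    1 / x ≤ 1 / Real.sin x ∧ 1 / Real.sin x ≤ 1 / x + 1 := by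
  have hs : 0 < Real.sin x := Real.sin_pos_of_pos_of_lt_pi h0 (by linarith [Real.pi_pos])
  have hc : 0 < Real.cos x := Real.cos_pos_of_mem_Ioo ⟨by linarith, h1⟩
  refine ⟨one_div_le_one_div_of_le hs (Real.sin_lt h0).le, ?_⟩
  have h2 := Real.lt_tan h0 h1
  rw [Real.tan_eq_sin_div_cos, lt_div_iff₀ hc] at h2
  have h3 : 1 ≤ Real.sin x + Real.cos x := by
    nlinarith [Real.sin_sq_add_cos_sq x]
  rw [div_add_one h0.ne', div_le_div_iff₀ hs h0]
  nlinarith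

theorem sum_Ioo_inv_eq_harmonic (R : ℕ) :
    ∑ j ∈ Finset.Ioo 0 (R + 1), 1 / (j : ℝ) = (harmonic R : ℝ) := by
  rw [← sum_range_succ_eq_sum_Ioo R (fun j => 1 / (j : ℝ)), harmonic]
  push_cast
  exact Finset.sum_congr rfl fun i _ => by rw [one_div]

/-- By symmetry the sum is twice that over $\theta_j<\pi/2$ plus the middle term; there $1/\theta_j$
sums to $\frac{2(R+1)}\pi H_R$. The slack $5(R+1)$ absorbs the middle term, the `+ 1` of
`inv_sin_bounds` and that of the harmonic bound. -/
theorem sum_inv_sin_bounds (R : ℕ) :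
    4 * (R + 1) / Real.pi * Real.log (R + 1) ≤
        ∑ j ∈ Finset.Ioo 0 (2 * (R + 1)), 1 / Real.sin (angle R j) ∧
      ∑ j ∈ Finset.Ioo 0 (2 * (R + 1)), 1 / Real.sin (angle R j) ≤
        4 * (R + 1) / Real.pi * Real.log (R + 1) + 5 * (R + 1) := by
  have hpi := Real.pi_pos
  have hR1 : (0 : ℝ) ≤ R := by positivity
  rw [sum_Ioo_two_mul_of_symm R _ fun k _ hk => by rw [sin_angle_reflect (by omega)], angle_middle,
    Real.sin_pi_div_two]
  have hang : ∀ j ∈ Finset.Ioo 0 (R + 1), 1 / angle R j = 2 * (R + 1) / Real.pi * (1 / (j : ℝ)) := by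
    intro j _
    unfold angle
    rw [one_div_div, div_mul_div_comm, mul_one]
  have hb : ∀ j ∈ Finset.Ioo 0 (R + 1), 1 / angle R j ≤ 1 / Real.sin (angle R j) ∧
      1 / Real.sin (angle R j) ≤ 1 / angle R j + 1 := fun j hj =>
    inv_sin_bounds (angle_pos (Finset.mem_Ioo.1 hj).1) (angle_lt_pi_div_two (Finset.mem_Ioo.1 hj).2)
  have hlo := Finset.sum_le_sum fun j hj => (hb j hj).1
  have hup := Finset.sum_le_sum fun j hj => (hb j hj).2
  rw [Finset.sum_add_distrib, Finset.sum_const, Nat.card_Ioo, nsmul_one] at hup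
  rw [Finset.sum_congr rfl hang, ← Finset.mul_sum, sum_Ioo_inv_eq_harmonic] at hlo hup
  have h1 : Real.log (R + 1) ≤ (harmonic R : ℝ) := by exact_mod_cast log_add_one_le_harmonic R
  have h2 : (harmonic R : ℝ) ≤ 1 + Real.log (R + 1) := by
    refine (harmonic_le_one_add_log R).trans ?_
    rcases Nat.eq_zero_or_pos R with rfl | hR
    · simp
    · have : (0 : ℝ) < R := by exact_mod_cast hR
      linarith [Real.log_le_log this (by linarith : (R : ℝ) ≤ R + 1)]
  have hA : 0 < 2 * (R + 1 : ℝ) / Real.pi := by positivity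
  have h1' := mul_le_mul_of_nonneg_left h1 hA.le
  have h2' := mul_le_mul_of_nonneg_left h2 hA.le
  have hA1 : 2 * (R + 1 : ℝ) / Real.pi ≤ R + 1 := by
    rw [div_le_iff₀ hpi]
    nlinarith [Real.pi_gt_three]
  have hcast : ((R + 1 - 0 - 1 : ℕ) : ℝ) = R := by simp
  rw [hcast] at hup
  have e : 4 * (R + 1 : ℝ) / Real.pi * Real.log (R + 1) =
      2 * (2 * (R + 1 : ℝ) / Real.pi * Real.log (R + 1)) := by ring
  rw [e]
  constructor <;> linarith

/-- With $n=R+1$ the errors are $8n^2+2$ from the Riemann sums, $10n^2$ from the sum of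
$1/\sin\theta_j$ and $1$ from the central mode; half the total is at most $11n^2$. -/
theorem abs_zetaOne_srwStep_sub_le (x : ℤ × ℤ) (R : ℕ) :
    |zetaOne (srwStep squareLattice) (ball squareLattice x R) -
      4 / Real.pi * ((R + 1 : ℝ) ^ 2 * Real.log (R + 1))| ≤ 11 * (R + 1 : ℝ) ^ 2 := by
  rw [zetaOne_srwStep]
  have hR : (1 : ℝ) ≤ R + 1 := by
    have : (0 : ℝ) ≤ R := by positivity
    linarith
  have h1 : |∑ j ∈ Finset.Ioo 0 (2 * (R + 1)), (∑ k ∈ Finset.Ioo 0 (2 * (R + 1)),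
      1 / (1 - Real.cos (angle R j) * Real.cos (angle R k)) - 2 * (R + 1) / Real.sin (angle R j))| ≤
      ∑ j ∈ Finset.Ioo 0 (2 * (R + 1)), 2 * (1 / Real.sin (angle R j) ^ 2) := by
    refine (Finset.abs_sum_le_sum_abs _ _).trans (Finset.sum_le_sum fun j hj => ?_)
    rw [Finset.mem_Ioo] at hj
    exact abs_sum_poisson_sub_le R (Real.sin_pos_of_pos_of_lt_pi (angle_pos hj.1) (angle_lt_pi hj.2))
      (Real.cos_sq_add_sin_sq _)
  have h2 := sum_inv_sin_sq_le R
  obtain ⟨h3, h4⟩ := sum_inv_sin_bounds R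
  have e : ∑ j ∈ Finset.Ioo 0 (2 * (R + 1)), 2 * (R + 1) / Real.sin (angle R j) =
      2 * (R + 1) * ∑ j ∈ Finset.Ioo 0 (2 * (R + 1)), 1 / Real.sin (angle R j) := by
    rw [Finset.mul_sum]
    exact Finset.sum_congr rfl fun j _ => by ring
  rw [Finset.sum_sub_distrib, e, ← Finset.mul_sum] at h1
  set S := ∑ j ∈ Finset.Ioo 0 (2 * (R + 1)), ∑ k ∈ Finset.Ioo 0 (2 * (R + 1)),
      1 / (1 - Real.cos (angle R j) * Real.cos (angle R k))
  set T := ∑ j ∈ Finset.Ioo 0 (2 * (R + 1)), 1 / Real.sin (angle R j)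
  set W := ∑ j ∈ Finset.Ioo 0 (2 * (R + 1)), 1 / Real.sin (angle R j) ^ 2
  have hM : (0 : ℝ) ≤ 2 * (R + 1) := by linarith
  have h3' := mul_le_mul_of_nonneg_left h3 hM
  have h4' := mul_le_mul_of_nonneg_left h4 hM
  have e1 : 2 * (R + 1 : ℝ) * (4 * (R + 1) / Real.pi * Real.log (R + 1)) =
      2 * (4 / Real.pi * ((R + 1 : ℝ) ^ 2 * Real.log (R + 1))) := by ring
  rw [mul_add (2 * (R + 1 : ℝ)), e1] at h4'
  rw [e1] at h3'
  rw [abs_le] at h1 ⊢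
  have hsq : 1 ≤ (R + 1 : ℝ) ^ 2 := one_le_pow₀ hR
  have e2 : 2 * (R + 1 : ℝ) * (5 * (R + 1)) = 10 * (R + 1 : ℝ) ^ 2 := by ring
  rw [e2] at h4'
  constructor <;> linarith [h1.1, h1.2]

/-! ### Limits along balls -/

theorem tendsto_log_natCast_add_one :
    Tendsto (fun R : ℕ => Real.log ((R : ℝ) + 1)) atTop atTop :=
  Real.tendsto_log_atTop.comp
    (tendsto_atTop_add_const_right _ _ tendsto_natCast_atTop_atTop)

theorem tendsto_zetaOne_srwStep_div (x : ℤ × ℤ) :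
    Tendsto (fun R : ℕ => zetaOne (srwStep squareLattice) (ball squareLattice x R) /
      ((R + 1 : ℝ) ^ 2 * Real.log (R + 1))) atTop (𝓝 (4 / Real.pi)) := by
  rw [tendsto_iff_norm_sub_tendsto_zero]
  have h : Tendsto (fun R : ℕ => 11 / Real.log ((R : ℝ) + 1)) atTop (𝓝 0) :=
    tendsto_log_natCast_add_one.const_div_atTop 11
  refine squeeze_zero' (Eventually.of_forall fun _ => norm_nonneg _) ?_ h
  filter_upwards [eventually_gt_atTop 0] with R hR
  have hR' : (0 : ℝ) < R := by exact_mod_cast hR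
  have hlog : 0 < Real.log ((R : ℝ) + 1) := Real.log_pos (by linarith)
  have hb := abs_zetaOne_srwStep_sub_le x R
  have hD : 0 < (R + 1 : ℝ) ^ 2 * Real.log (R + 1) := by positivity
  rw [Real.norm_eq_abs, div_sub' hD.ne', abs_div, abs_of_pos hD, mul_comm _ (4 / Real.pi),
    div_le_div_iff₀ hD hlog]
  calc _ ≤ 11 * (R + 1 : ℝ) ^ 2 * Real.log (R + 1) := mul_le_mul_of_nonneg_right hb hlog.le
    _ = _ := by ring

theorem tendsto_card_ball_div (x : ℤ × ℤ) :
    Tendsto (fun R : ℕ => ((ball squareLattice x R).card : ℝ) / (R + 1 : ℝ) ^ 2) atTop (𝓝 2) := by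
  have h0 : Tendsto (fun R : ℕ => 1 / ((R : ℝ) + 1)) atTop (𝓝 0) :=
    tendsto_one_div_add_atTop_nhds_zero_nat
  have h : Tendsto (fun R : ℕ => 2 - 2 * (1 / ((R : ℝ) + 1)) + (1 / ((R : ℝ) + 1)) ^ 2) atTop
      (𝓝 (2 - 2 * 0 + 0 ^ 2)) := ((h0.const_mul 2).const_sub 2).add (h0.pow 2)
  norm_num at h
  refine h.congr fun R => ?_
  have : ((R : ℝ) + 1) ≠ 0 := by positivity
  rw [card_ball]
  field_simp
  ring

theorem card_ball_pos (x : ℤ × ℤ) (R : ℕ) : (0 : ℝ) < (ball squareLattice x R).card := by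
  rw [card_ball]
  positivity

/-- With $n=R+1$: $N\sim2n^2$ and $\log N=2\log n+O(1)$, whence the constant $2\cdot2$. -/
theorem tendsto_card_ball_mul_log_div (x : ℤ × ℤ) :
    Tendsto (fun R : ℕ => ((ball squareLattice x R).card *
      Real.log (ball squareLattice x R).card : ℝ) / ((R + 1 : ℝ) ^ 2 * Real.log (R + 1)))
      atTop (𝓝 4) := by
  have h1 := tendsto_card_ball_div x
  have h2 : Tendsto (fun R : ℕ => Real.log (((ball squareLattice x R).card : ℝ) / (R + 1 : ℝ) ^ 2))
      atTop (𝓝 (Real.log 2)) := h1.log two_ne_zero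
  have h3 : Tendsto (fun R : ℕ => 2 + Real.log (((ball squareLattice x R).card : ℝ) /
      (R + 1 : ℝ) ^ 2) / Real.log ((R : ℝ) + 1)) atTop (𝓝 (2 + 0)) :=
    (h2.div_atTop tendsto_log_natCast_add_one).const_add 2
  have h4 := h1.mul h3
  norm_num at h4
  refine h4.congr' ?_
  filter_upwards [eventually_gt_atTop 0] with R hR
  have hR' : (0 : ℝ) < R := by exact_mod_cast hR
  have hlog : Real.log ((R : ℝ) + 1) ≠ 0 := (Real.log_pos (by linarith)).ne'
  have hne : ((R : ℝ) + 1) ≠ 0 := by positivity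
  rw [Real.log_div (card_ball_pos x R).ne' (pow_ne_zero 2 hne), Real.log_pow]
  push_cast
  field_simp
  ring

theorem tendsto_zetaOne_srwStep (x : ℤ × ℤ) :
    Tendsto (fun R : ℕ => zetaOne (srwStep squareLattice) (ball squareLattice x R) /
      ((ball squareLattice x R).card * Real.log (ball squareLattice x R).card)) atTop
      (𝓝 (1 / Real.pi)) := by
  have h := (tendsto_zetaOne_srwStep_div x).div (tendsto_card_ball_mul_log_div x) four_ne_zero
  rw [show 4 / Real.pi / 4 = 1 / Real.pi by ring] at h
  refine h.congr' ?_
  filter_upwards [eventually_gt_atTop 0] with R hR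
  have hR' : (0 : ℝ) < R := by exact_mod_cast hR
  have hlog : 0 < Real.log ((R : ℝ) + 1) := Real.log_pos (by linarith)
  have hD : 0 < (R + 1 : ℝ) ^ 2 * Real.log (R + 1) := by positivity
  exact div_div_div_cancel_right₀ hD.ne' _ _

theorem tendsto_card_ball (x : ℤ × ℤ) :
    Tendsto (fun R : ℕ => (ball squareLattice x R).card) atTop atTop := by
  refine tendsto_atTop_mono (fun R => ?_) tendsto_id
  have h : (R : ℝ) ≤ (ball squareLattice x R).card := by
    rw [card_ball]
    nlinarith [sq_nonneg (R : ℝ), Nat.cast_nonneg (α := ℝ) R]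
  exact_mod_cast h

end LatticeZeta

theorem mainTheorem4 :
    -- the lazy walk: covariance matrix and heat-kernel constant
    (∀ x, stepCovariance (lsrwStep squareLattice) x = (1 / 4 : ℝ) • 1 ∧
      covarianceConstant (stepCovariance (lsrwStep squareLattice) x) = 2 / Real.pi) ∧
    IsHeatKernelConstant (lsrwStep squareLattice) (2 / Real.pi) ∧
    -- the non-lazy walk: covariance matrix and the constant given by it
    (∀ x, stepCovariance (srwStep squareLattice) x = (1 / 2 : ℝ) • 1 ∧
      covarianceConstant (stepCovariance (srwStep squareLattice) x) = 1 / Real.pi) ∧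
    -- the zeta values on balls are well defined
    (∀ (x₀ : ℤ × ℤ) (R : ℕ),
      ZetaWellDefined (lsrwStep squareLattice) (ball squareLattice x₀ R) ∧
      ZetaWellDefined (srwStep squareLattice) (ball squareLattice x₀ R)) ∧
    -- the limits along every exhaustion by balls
    (∀ (x₀ : ℤ × ℤ) (R : ℕ → ℕ), Tendsto R atTop atTop →
      ∀ (N : ℕ → ℕ), (∀ n, N n = (ball squareLattice x₀ (R n)).card) →
      ∀ (Z Z' : ℕ → ℝ),
      (∀ n, Z n = zetaOne (lsrwStep squareLattice) (ball squareLattice x₀ (R n))) →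
      (∀ n, Z' n = zetaOne (srwStep squareLattice) (ball squareLattice x₀ (R n))) →
      Tendsto N atTop atTop ∧
      Tendsto (fun n => Z n / (N n * Real.log (N n))) atTop (𝓝 (2 / Real.pi)) ∧
      Tendsto (fun n => 2 * (N n * Real.log (N n)) / Z n) atTop (𝓝 Real.pi) ∧
      Tendsto (fun n => Z' n / (N n * Real.log (N n))) atTop (𝓝 (1 / Real.pi))) := by
  have hpi := Real.pi_pos
  refine ⟨fun x => ?_, isHeatKernelConstant_lsrwStep, fun x => ?_, fun x₀ R => ?_, ?_⟩
  · rw [stepCovariance_lsrwStep, covarianceConstant_smul_one (by norm_num)]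
    refine ⟨rfl, ?_⟩
    field_simp
    norm_num
  · rw [stepCovariance_srwStep, covarianceConstant_smul_one (by norm_num)]
    refine ⟨rfl, ?_⟩
    field_simp
  · exact ⟨zetaWellDefined_of_summable _ _ lsrwStep_comm (summable_lsrwStep x₀ R),
      zetaWellDefined_of_summable _ _ srwStep_comm (summable_srwStep x₀ R)⟩
  · intro x₀ R hR N hN Z Z' hZ hZ'
    obtain rfl : N = fun n => (ball squareLattice x₀ (R n)).card := funext hN
    obtain rfl : Z' = fun n => zetaOne (srwStep squareLattice) (ball squareLattice x₀ (R n)) :=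
      funext hZ'
    obtain rfl : Z = fun n => 2 * zetaOne (srwStep squareLattice) (ball squareLattice x₀ (R n)) :=
      funext fun n => (hZ n).trans (zetaOne_lsrwStep x₀ (R n))
    -- The limit in the radius composes with any sequence of radii tending to infinity; monotonicity
    -- plays no role.
    have h1 := (tendsto_zetaOne_srwStep x₀).comp hR
    have h2 : Tendsto (fun n => 2 * zetaOne (srwStep squareLattice) (ball squareLattice x₀ (R n)) /
        ((ball squareLattice x₀ (R n)).card * Real.log (ball squareLattice x₀ (R n)).card)) atTop
        (𝓝 (2 / Real.pi)) := by
      have h := h1.const_mul 2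
      rw [mul_one_div] at h
      exact h.congr fun n => (mul_div_assoc _ _ _).symm
    refine ⟨(tendsto_card_ball x₀).comp hR, h2, ?_, h1⟩
    have h3 := (h2.inv₀ (by positivity)).const_mul 2
    rw [inv_div, mul_div_cancel₀ _ two_ne_zero] at h3
    exact h3.congr fun n => by rw [inv_div, ← mul_div_assoc]
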